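/- **Notation.** $\mathbb Z^+$ is the set of non-negative integers and $\mathbb R^+=[0,+\infty)$. $K^+$ is the set of continuous functions $\mathbb R^+\to(0,+\infty)$. $K_\infty$ is the set of continuous, strictly increasing, unbounded functions $a:\mathbb R^+\to\mathbb R^+$ with $a(0)=0$. $KL$ is the set of continuous functions $\sigma:\mathbb R^+\times\mathbb R^+\to\mathbb R^+$ such that, for each $t$, $\sigma(\cdot,t)$ is strictly increasing with $\sigma(0,t)=0$ and, for each $s$, $\sigma(s,\cdot)$ is non-increasing with $\lim_{t\to+\infty}\sigma(s,t)=0$. For a set $A$, $M_A$ is the set of sequences in $A$ indexed by $\mathbb Z^+$. **Systems.** Let $\mathcal X,\mathcal Y,U$ be real normed linear spaces, $D$ a set, $f:\mathbb Z^+\times D\times\mathcal X\times U\to\mathcal X$ and $H:\mathbb Z^+\times\mathcal X\to\mathcal Y$. Consider $$x(t+1)=f(t,d(t),x(t),u(t)),\qquad Y(t)=H(t,x(t)),\qquad d\in M_D,\ u\in M_U. \tag{1.2}$$ **Hypotheses.** A map $G:\mathbb Z^+\times\mathcal X\to\mathcal W$ into a normed space has property (P) if for all bounded $I\subset\mathbb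 Z^+$, $S\subset\mathcal X$ and all $\varepsilon>0$ the set $G(I\times S)$ is bounded and there is $\delta>0$ with $\|G(t,x)-G(t,x_0)\|<\varepsilon$ for all $t\in I$ and $x,x_0\in S$ with $\|x-x_0\|<\delta$. $CU(\mathbb Z^+\times\mathcal X;\mathbb R^+)$ is the set of continuous maps $\mathbb Z^+\times\mathcal X\to\mathbb R^+$ with property (P). * (H2): $H$ has property (P), and $H(t,0)=0$ for all $t\in\mathbb Z^+$. * (A1): there are $a\in K_\infty$, $\beta\in K^+$ with $\|f(t,d,x,u)\|\le a(\beta(t)\|x\|)+a(\beta(t)\|u\|)$ for all $(t,d,x,u)$. * (A2): for all bounded $S\subset\mathcal X\times U$, $I\subset\mathbb Z^+$ and all $\varepsilon>0$ the set $f(I\times D\times S)$ is bounded and there is $\delta>0$ with $\sup_{d\in D}\|f(t,d,x,u)-f(t,d,x_0,u_0)\|<\varepsilon$ for all $t\in I$ and $(x,u),(x_0,u_0)\in S$ with $\|x-x_0\|+\|u-u_0\|<\delta$; moreover $f(t,d,0,0)=0$ for all $(t,d)$. **RGAOS.** Let $F:\mathbb Z^+\times E\times\mathcal X\to\mathcal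 X$. The system $x(t+1)=F(t,e(t),x(t))$, $Y(t)=H(t,x(t))$, $e\in M_E$, is non-uniformly in time Robustly Globally Asymptotically Output Stable (RGAOS) if, $x(t)$, $t\ge t_0$, denoting the solution with $x(t_0)=x_0$ for the disturbance $e$: * for all $\varepsilon>0$ and $T\in\mathbb Z^+$, $\sup\{\|H(t,x(t))\| : t\ge t_0,\ \|x_0\|\le\varepsilon,\ t_0\in[0,T],\ e\in M_E\}<+\infty$, and there is $\delta>0$ such that $\|x_0\|\le\delta$ and $t_0\in[0,T]$ imply $\|H(t,x(t))\|\le\varepsilon$ for all $t\ge t_0$ and $e\in M_E$; * for all $\varepsilon>0$, $T\in\mathbb Z^+$ and $R\ge0$ there is $\tau\in\mathbb Z^+$ such that $\|x_0\|\le R$ and $t_0\in[0,T]$ imply $\|H(t,x(t))\|\le\varepsilon$ for all $t\ge t_0+\tau$ and $e\in M_E$. **Proposition 3.2.** Suppose that (A1) and (H2) hold. Then the following statements are equivalent. (i) (Non-uniform in time Input-to-Output Stability, IOS.) There are $\sigma\in KL$, $\beta,\gamma\in K^+$ and $\rho\in K_\infty$ such that for all $(t_0,x_0,d,u)\in\mathbb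 Z^+\times\mathcal X\times M_D\times M_U$ the solution $x(t)$ of (1.2) with $x(t_0)=x_0$ satisfies, for all integers $t\ge t_0$, $$\|H(t,x(t))\|\le\max\Big\{\sigma(\beta(t_0)\|x_0\|,t-t_0),\ \sup_{t_0\le\tau\le t}\sigma\big(\beta(\tau)\rho(\gamma(\tau)\|u(\tau)\|),t-\tau\big)\Big\}.$$ (ii) There are $\zeta\in K_\infty$, $\beta,\delta\in K^+$ and $\sigma\in KL$ such that for all $(t_0,x_0,d,u)\in\mathbb Z^+\times\mathcal X\times M_D\times M_U$ the solution $x(t)$ of (1.2) with $x(t_0)=x_0$ satisfies, for all integers $t\ge t_0$, $$\|H(t,x(t))\|\le\max\Big\{\sigma(\beta(t_0)\|x_0\|,t-t_0),\ \sup_{t_0\le\tau\le t}\zeta(\delta(\tau)\|u(\tau)\|)\Big\}.$$ (iii) There are $\theta\in K_\infty$ and $p\in K^+$ such that the system $$x(t+1)=f\big(t,d(t),x(t),p(t)\theta(\|x(t)\|)d'(t)\big),\quad Y(t)=H(t,x(t)),\quad (d(t),d'(t))\in D\times B[0,1],$$ where $B[0,1]=\{u\in U:\|u\|\le1\}$,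 is RGAOS (with disturbance $(d,d')$). (iv) There are $V:\mathbb Z^+\times\mathcal X\to\mathbb R^+$, $a_1,a_2,a_3\in K_\infty$, $\beta,\phi,\mu\in K^+$ and $\lambda\in(0,1)$ such that $$a_1\big(\|H(t,x)\|+\mu(t)\|x\|\big)\le V(t,x)\le a_2(\beta(t)\|x\|)\quad\text{for all }(t,x)\in\mathbb Z^+\times\mathcal X,$$ $$V(t+1,f(t,d,x,u))\le\lambda V(t,x)+a_3(\phi(t)\|u\|)\quad\text{for all }(t,x,d,u)\in\mathbb Z^+\times\mathcal X\times D\times U.$$ Moreover, if (A2) and (H2) hold, then (i)–(iv) are equivalent to one another and to the existence of $V,a_1,a_2,a_3,\beta,\phi,\mu,\lambda$ as in (iv) with, in addition, $V\in CU(\mathbb Z^+\times\mathcal X;\mathbb R^+)$. -/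

import Mathlib

open scoped NNReal ENNReal

/-! Time-varying discrete-time systems: comparison functions, stability notions, hypotheses.
The half-line `[0, +∞)` is the type `ℝ≥0` throughout, and the set of times is `ℕ`. -/

namespace DTSystem

/-- Class `K∞`: continuous, strictly increasing, zero at zero, unbounded. -/
structure IsKInf (a : ℝ≥0 → ℝ≥0) : Prop where
  continuous : Continuous a
  strictMono : StrictMono a
  map_zero : a 0 = 0
  tendsto_atTop : Filter.Tendsto a Filter.atTop Filter.atTop

/-- Class `KL`: continuous on `[0,∞) × [0,∞)`, of class `K` in the first variable, decreasing
(in the wide sense) to zero in the second one. -/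
structure IsKL (σ : ℝ≥0 → ℝ≥0 → ℝ≥0) : Prop where
  continuous : Continuous (Function.uncurry σ)
  strictMono : ∀ t, StrictMono fun s => σ s t
  map_zero : ∀ t, σ 0 t = 0
  antitone : ∀ s, Antitone (σ s)
  tendsto_zero : ∀ s, Filter.Tendsto (σ s) Filter.atTop (nhds 0)

/-- Class `K⁺`: continuous positive functions on `[0, +∞)`. -/
structure IsKPlus (β : ℝ≥0 → ℝ≥0) : Prop where
  continuous : Continuous β
  pos : ∀ t, 0 < β t

section

variable {D X U Y : Type*}
  [NormedAddCommGroup X] [NormedSpace ℝ X]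
  [NormedAddCommGroup U] [NormedSpace ℝ U]
  [NormedAddCommGroup Y] [NormedSpace ℝ Y]

/-- On bounded sets `I × S` of times and points the map `G` is bounded, and it is uniformly
continuous in the point, uniformly in the time. -/
def BoundedUniformOnBounded (G : ℕ → X → Y) : Prop :=
  ∀ (I : Set ℕ) (S : Set X), Bornology.IsBounded I → Bornology.IsBounded S →
    ∀ ε : ℝ, 0 < ε →
      Bornology.IsBounded (Function.uncurry G '' (I ×ˢ S)) ∧
      ∃ δ : ℝ, 0 < δ ∧ ∀ t ∈ I, ∀ x ∈ S, ∀ x₀ ∈ S, ‖x - x₀‖ < δ → ‖G t x - G t x₀‖ < ε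

/-- The class `CU(ℕ × X; Y)`. -/
def IsCU (G : ℕ → X → Y) : Prop :=
  Continuous (Function.uncurry G) ∧ BoundedUniformOnBounded G

/-- Hypothesis on the output map `H`: local boundedness and uniformity, and `H(t,0) = 0`. -/
def HypH2 (H : ℕ → X → Y) : Prop :=
  BoundedUniformOnBounded H ∧ ∀ t, H t 0 = 0

/-- Growth hypothesis on the dynamics `f`. -/
def HypA1 (f : ℕ → D → X → U → X) : Prop :=
  ∃ a β : ℝ≥0 → ℝ≥0, IsKInf a ∧ IsKPlus β ∧
    ∀ (t : ℕ) (x : X) (d : D) (u : U),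
      ‖f t d x u‖₊ ≤ a (β t * ‖x‖₊) + a (β t * ‖u‖₊)

/-- Continuity hypothesis on the dynamics `f`. The supremum over the disturbances is taken in
`[0, +∞]`. -/
def HypA2 (f : ℕ → D → X → U → X) : Prop :=
  (∀ (S : Set (X × U)) (I : Set ℕ), Bornology.IsBounded S → Bornology.IsBounded I →
    ∀ ε : ℝ, 0 < ε →
      Bornology.IsBounded {y : X | ∃ t ∈ I, ∃ d : D, ∃ z ∈ S, f t d z.1 z.2 = y} ∧
      ∃ δ : ℝ, 0 < δ ∧ ∀ t ∈ I, ∀ z ∈ S, ∀ z₀ ∈ S, ‖z.1 - z₀.1‖ + ‖z.2 - z₀.2‖ < δ →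
        (⨆ d : D, ‖f t d z.1 z.2 - f t d z₀.1 z₀.2‖ₑ) < ENNReal.ofReal ε) ∧
  ∀ (t : ℕ) (d : D), f t d 0 0 = 0

/-- `x` solves `x(t+1) = g(t, x(t))`, `t ≥ t₀`, with `x(t₀) = x₀`. The values `x(t)`, `t ≥ t₀`,
exist and are determined by recursion; those with `t < t₀` play no role. -/
def IsSolution (g : ℕ → X → X) (t₀ : ℕ) (x₀ : X) (x : ℕ → X) : Prop :=
  x t₀ = x₀ ∧ ∀ t, t₀ ≤ t → x (t + 1) = g t (x t)

/-- Non-uniform in time Robust Global Asymptotic Output Stability of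
`x(t+1) = F(t, d(t), x(t))`, `Y(t) = H(t, x(t))`: the first two conjuncts are robust output
stability, the third one is robust output attractivity. -/
def IsRGAOS (F : ℕ → D → X → X) (H : ℕ → X → Y) : Prop :=
  (∀ ε : ℝ, 0 < ε → ∀ T : ℕ,
    BddAbove {r : ℝ | ∃ (t₀ : ℕ) (x₀ : X) (d : ℕ → D) (x : ℕ → X) (t : ℕ),
      t₀ ≤ T ∧ ‖x₀‖ ≤ ε ∧ IsSolution (fun s => F s (d s)) t₀ x₀ x ∧ t₀ ≤ t ∧
      r = ‖H t (x t)‖}) ∧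
  (∀ ε : ℝ, 0 < ε → ∀ T : ℕ, ∃ δ : ℝ, 0 < δ ∧
    ∀ (t₀ : ℕ) (x₀ : X), ‖x₀‖ ≤ δ → t₀ ≤ T →
      ∀ (d : ℕ → D) (x : ℕ → X), IsSolution (fun s => F s (d s)) t₀ x₀ x →
        ∀ t, t₀ ≤ t → ‖H t (x t)‖ ≤ ε) ∧
  (∀ ε : ℝ, 0 < ε → ∀ (T : ℕ) (R : ℝ), 0 ≤ R → ∃ τ : ℕ,
    ∀ (t₀ : ℕ) (x₀ : X), ‖x₀‖ ≤ R → t₀ ≤ T →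
      ∀ (d : ℕ → D) (x : ℕ → X), IsSolution (fun s => F s (d s)) t₀ x₀ x →
        ∀ t, t₀ + τ ≤ t → ‖H t (x t)‖ ≤ ε)

/-- Non-uniform in time Input-to-Output Stability of `x(t+1) = f(t, d(t), x(t), u(t))`,
`Y(t) = H(t, x(t))` from the input `u`. -/
def IsIOS (f : ℕ → D → X → U → X) (H : ℕ → X → Y) : Prop :=
  ∃ (σ : ℝ≥0 → ℝ≥0 → ℝ≥0) (β γ ρ : ℝ≥0 → ℝ≥0),
    IsKL σ ∧ IsKPlus β ∧ IsKPlus γ ∧ IsKInf ρ ∧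
    ∀ (u : ℕ → U) (t₀ : ℕ) (x₀ : X) (d : ℕ → D) (x : ℕ → X),
      IsSolution (fun s y => f s (d s) y (u s)) t₀ x₀ x →
      ∀ t : ℕ, t₀ ≤ t →
        ‖H t (x t)‖₊ ≤ max (σ (β t₀ * ‖x₀‖₊) ((t - t₀ : ℕ) : ℝ≥0))
          ((Finset.Icc t₀ t).sup fun τ : ℕ =>
            σ (β τ * ρ (γ τ * ‖u τ‖₊)) ((t - τ : ℕ) : ℝ≥0))

/-- The output estimate in which the effect of the input does not fade. -/
def HasSupGainEstimate (f : ℕ → D → X → U → X) (H : ℕ → X → Y) : Prop :=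
  ∃ (ζ β δ : ℝ≥0 → ℝ≥0) (σ : ℝ≥0 → ℝ≥0 → ℝ≥0),
    IsKInf ζ ∧ IsKPlus β ∧ IsKPlus δ ∧ IsKL σ ∧
    ∀ (t₀ : ℕ) (x₀ : X) (d : ℕ → D) (u : ℕ → U) (x : ℕ → X),
      IsSolution (fun s y => f s (d s) y (u s)) t₀ x₀ x →
      ∀ t : ℕ, t₀ ≤ t →
        ‖H t (x t)‖₊ ≤ max (σ (β t₀ * ‖x₀‖₊) ((t - t₀ : ℕ) : ℝ≥0))
          ((Finset.Icc t₀ t).sup fun τ : ℕ => ζ (δ τ * ‖u τ‖₊))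

/-- The dynamics `f(t, d, x, p(t) θ(‖x‖) d')` with disturbance `(d, d') ∈ D × B[0,1]`, where
`B[0,1]` is the closed unit ball of `U`. -/
def feedbackDynamics (f : ℕ → D → X → U → X) (p θ : ℝ≥0 → ℝ≥0) :
    ℕ → D × Metric.closedBall (0 : U) 1 → X → X :=
  fun t e x => f t e.1 x (((p t * θ ‖x‖₊ : ℝ≥0) : ℝ) • (e.2 : U))

/-- For some `θ ∈ K∞` and `p ∈ K⁺` the system with dynamics `feedbackDynamics f p θ` and output
map `H` is RGAOS. -/
def HasStabilityMargin (f : ℕ → D → X → U → X) (H : ℕ → X → Y) : Prop :=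
  ∃ θ p : ℝ≥0 → ℝ≥0, IsKInf θ ∧ IsKPlus p ∧ IsRGAOS (feedbackDynamics f p θ) H

/-- `V` is a Lyapunov function for the system `(f, H)`, for some comparison functions and some
rate in `(0,1)`. -/
def IsLyapunov (f : ℕ → D → X → U → X) (H : ℕ → X → Y) (V : ℕ → X → ℝ≥0) : Prop :=
  ∃ (a₁ a₂ a₃ β φ μ : ℝ≥0 → ℝ≥0) (lam : ℝ≥0),
    IsKInf a₁ ∧ IsKInf a₂ ∧ IsKInf a₃ ∧ IsKPlus β ∧ IsKPlus φ ∧ IsKPlus μ ∧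
    0 < lam ∧ lam < 1 ∧
    (∀ (t : ℕ) (x : X),
      a₁ (‖H t x‖₊ + μ t * ‖x‖₊) ≤ V t x ∧ V t x ≤ a₂ (β t * ‖x‖₊)) ∧
    ∀ (t : ℕ) (x : X) (d : D) (u : U),
      V (t + 1) (f t d x u) ≤ lam * V t x + a₃ (φ t * ‖u‖₊)

end

end DTSystem

/-!
The implications form a cycle: input-to-output stability (the effect of the input fades) ⇒ sup gain
estimate ⇒ stability margin ⇒ Lyapunov function ⇒ input-to-output stability. Throughout,
countably many gains, one for each time `t`, have to be replaced by a single `K∞` function `a` and a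
rescaling `a (β t * s)` with `β` of class `K⁺`; this is always possible
(`exists_isKInf_isKPlus_bound`), and it also yields `HypA1` from `HypA2`.

* From the sup gain to the margin take `θ = id` and a rapidly decreasing `p`. The growth hypothesis
  bounds `‖x t‖` by a gain of `‖x t₀‖` that depends only on `t`, so a suitable `p` makes the effect of
  the feedback `p t * ‖x t‖` on the output fade uniformly (`exists_weight_isFading`). Attractivity
  follows by restarting the estimate at a late time.

* From the margin to a Lyapunov function, a weight `μ` of the same kind turns `‖H t x‖` into
  `Z t x = ‖H t x‖ + μ t * ‖x‖` without losing stability. Let `W k t x` be the worst value of `Z`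
  after `k` steps of the feedback system from `x` at time `t`. With small positive `c m`, the function
  `V t x = ⨆ m, ⨆ k, c m * 2 ^ k * (W k t x - 1 / (m + 1))⁺` is halved at every step of that system
  (`two_mul_valueSup_le`). On a bounded set each threshold `1 / (m + 1)` leaves only finitely many `k`,
  and the decay of `c` leaves only finitely many `m`; so `V` is finite, small near `0`, and
  inherits uniform continuity from the `W k` (`WorstValueDecays.exists_lyapunov`). An input with
  `‖u‖ ≤ p t * θ ‖x‖` is an admissible feedback perturbation; for any other input both `‖x‖` and
  the next value of `V` are bounded in terms of `‖u‖` (`exists_input_gain`).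

* From a Lyapunov function to input-to-output stability, iterate the decrease estimate at a rate `r` strictly
  between the given one and `1`; the loss of rate turns the sum over past inputs into a supremum
  (`le_max_geometric_of_step`).
-/

namespace DTSystem

open Filter Topology

/-! ### Comparison functions -/

theorem IsKInf.id : IsKInf fun s => s :=
  ⟨continuous_id, strictMono_id, rfl, tendsto_id⟩

theorem IsKInf.add {a b : ℝ≥0 → ℝ≥0} (ha : IsKInf a) (hb : IsKInf b) :
    IsKInf fun s => a s + b s where
  continuous := ha.continuous.add hb.continuous
  strictMono := ha.strictMono.add hb.strictMono
  map_zero := by simp [ha.map_zero, hb.map_zero]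
  tendsto_atTop := tendsto_atTop_mono (fun s => le_self_add) ha.tendsto_atTop

theorem IsKInf.exists_le {a : ℝ≥0 → ℝ≥0} (ha : IsKInf a) (B : ℝ≥0) : ∃ s, B ≤ a s :=
  (ha.tendsto_atTop.eventually_ge_atTop B).exists

theorem IsKInf.exists_inverse {a : ℝ≥0 → ℝ≥0} (ha : IsKInf a) :
    ∃ b, IsKInf b ∧ ∀ s, b (a s) = s := by
  have hsurj : Function.Surjective a := by
    intro y
    obtain ⟨s, hs⟩ := ha.exists_le y
    obtain ⟨x, -, hx⟩ := intermediate_value_Icc zero_le ha.continuous.continuousOn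
      (⟨by simp [ha.map_zero], hs⟩ : y ∈ Set.Icc (a 0) (a s))
    exact ⟨x, hx⟩
  let e : ℝ≥0 ≃o ℝ≥0 := ha.strictMono.orderIsoOfSurjective a hsurj
  have he : ∀ s, e.symm (a s) = s := fun s => e.symm_apply_apply s
  refine ⟨e.symm, ⟨e.symm.continuous, e.symm.strictMono, ?_, e.symm.tendsto_atTop⟩, he⟩
  simpa [ha.map_zero] using he 0

/-- Every positive sequence is the restriction to the integers of a function of class `K⁺`. -/
theorem exists_isKPlus_eq (b : ℕ → ℝ≥0) (hb : ∀ n, 0 < b n) :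
    ∃ β, IsKPlus β ∧ ∀ n : ℕ, β n = b n := by
  obtain ⟨g, hg, hge⟩ := ContinuousMap.exists_extension_forall_mem_of_isClosedEmbedding
    (t := Set.Ioi (0 : ℝ)) (⟨fun n : ℕ => (b n : ℝ), continuous_of_discreteTopology⟩ : C(ℕ, ℝ))
    (fun n => NNReal.coe_pos.2 (hb n)) ⟨1, Set.mem_Ioi.2 one_pos⟩ Nat.isClosedEmbedding_coe_real
  refine ⟨fun s => (g s).toNNReal, ⟨by fun_prop, fun s => Real.toNNReal_pos.2 (hg s)⟩, fun n => ?_⟩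
  have := congrFun hge n
  simp only [Function.comp_apply, ContinuousMap.coe_mk] at this
  simp [this]

theorem exists_pos_le_of_lt {α : Type*} [LinearOrder α] [Zero α] {c : α} (hc : 0 < c)
    (δ : ℕ → α) (hδ : ∀ n, 0 < δ n) (N : ℕ) : ∃ η, 0 < η ∧ η ≤ c ∧ ∀ n < N, η ≤ δ n := by
  induction N with
  | zero => exact ⟨c, hc, le_rfl, by simp⟩
  | succ N ih =>
    obtain ⟨η, hη, hηc, h⟩ := ih
    refine ⟨min η (δ N), lt_min hη (hδ N), (min_le_left _ _).trans hηc, fun n hn => ?_⟩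
    rcases Nat.lt_succ_iff_lt_or_eq.1 hn with hn | rfl
    · exact (min_le_left _ _).trans (h n hn)
    · exact min_le_right _ _

/-- A monotone function that tends to `0` at `0` has a majorant of class `K∞`, namely
`s ↦ s + ∫ v in 1..2, χ (s v)`. -/
theorem exists_isKInf_ge_of_monotone (χ : ℝ≥0 → ℝ≥0) (hm : Monotone χ)
    (h0 : Tendsto χ (𝓝 0) (𝓝 0)) : ∃ a, IsKInf a ∧ ∀ s, χ s ≤ a s := by
  set h : ℝ → ℝ := fun s => χ s.toNNReal with hh
  have hmono : Monotone h := fun x y hxy => NNReal.coe_le_coe.2 (hm (Real.toNNReal_le_toNNReal hxy))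
  have hint : ∀ x y : ℝ, IntervalIntegrable h MeasureTheory.volume x y :=
    fun x y => hmono.intervalIntegrable
  set J : ℝ → ℝ := fun s => ∫ v in (1 : ℝ)..2, h (s * v) with hJ
  have hintJ : ∀ s : ℝ, 0 ≤ s →
      IntervalIntegrable (fun v => h (s * v)) MeasureTheory.volume 1 2 := fun s hs =>
    (hmono.comp (monotone_mul_left_of_nonneg hs)).intervalIntegrable
  have hJmono : ∀ s t : ℝ, 0 ≤ s → s ≤ t → J s ≤ J t := by
    intro s t hs hst
    refine intervalIntegral.integral_mono_on one_le_two (hintJ s hs) (hintJ t (hs.trans hst)) ?_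
    intro v hv
    exact hmono (mul_le_mul_of_nonneg_right hst (by linarith [hv.1]))
  have hJlow : ∀ s : ℝ, 0 ≤ s → h s ≤ J s := by
    intro s hs
    have := intervalIntegral.integral_mono_on one_le_two
      (intervalIntegrable_const (c := h s)) (hintJ s hs)
      fun v hv => hmono (le_mul_of_one_le_right hs hv.1)
    simpa [show (2 : ℝ) - 1 = 1 by norm_num] using this
  have hJup : ∀ s : ℝ, 0 ≤ s → J s ≤ h (s * 2) := by
    intro s hs
    have := intervalIntegral.integral_mono_on one_le_two (hintJ s hs)
      (intervalIntegrable_const (c := h (s * 2)))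
      fun v hv => hmono (mul_le_mul_of_nonneg_left hv.2 hs)
    simpa [show (2 : ℝ) - 1 = 1 by norm_num] using this
  have hJnn : ∀ s : ℝ≥0, 0 ≤ J s := fun s => (NNReal.coe_nonneg _).trans (hJlow s s.2)
  have hJcont : ∀ s : ℝ, s ≠ 0 → ContinuousAt J s := by
    intro s hs
    have hprim : Continuous fun x => ∫ v in (0 : ℝ)..x, h v :=
      intervalIntegral.continuous_primitive hint 0
    have heq : J =ᶠ[𝓝 s] fun s =>
        s⁻¹ * ((∫ v in (0 : ℝ)..(s * 2), h v) - ∫ v in (0 : ℝ)..s, h v) := by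
      filter_upwards [isOpen_ne.mem_nhds hs] with x hx
      rw [intervalIntegral.integral_interval_sub_left (hint _ _) (hint _ _), hJ]
      simp only
      rw [intervalIntegral.integral_comp_mul_left h hx, mul_one, smul_eq_mul]
    refine ContinuousAt.congr ?_ heq.symm
    exact (continuousAt_inv₀ hs).mul
      ((hprim.comp (continuous_id.mul continuous_const)).sub hprim).continuousAt
  have hχ0 : χ 0 = 0 := tendsto_nhds_unique (tendsto_pure_nhds χ 0 |>.mono_left le_rfl)
    (h0.mono_left (pure_le_nhds 0))
  have hJ0 : J 0 = 0 := by simp [hJ, hh, hχ0]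
  refine ⟨fun s => s + (J s).toNNReal, ⟨?_, ?_, ?_, ?_⟩, ?_⟩
  · refine continuous_id.add (continuous_iff_continuousAt.2 fun s => ?_)
    rcases eq_or_ne s 0 with rfl | hs
    · have hup : Tendsto (fun s : ℝ≥0 => χ (s * 2)) (𝓝 0) (𝓝 0) := by
        refine h0.comp ?_
        have : Continuous fun s : ℝ≥0 => s * 2 := by fun_prop
        simpa using this.tendsto 0
      unfold ContinuousAt
      simp only [NNReal.coe_zero, hJ0, Real.toNNReal_zero]
      refine tendsto_of_tendsto_of_tendsto_of_le_of_le tendsto_const_nhds hup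
        (fun s => zero_le) fun s => ?_
      refine Real.toNNReal_le_iff_le_coe.2 ((hJup s s.2).trans_eq ?_)
      simp [hh, Real.toNNReal_mul]
    · exact (continuous_real_toNNReal.continuousAt.comp
        (hJcont s (by simpa using hs))).comp NNReal.continuous_coe.continuousAt
  · intro s t hst
    exact add_lt_add_of_lt_of_le hst (Real.toNNReal_le_toNNReal (hJmono s t s.2 hst.le))
  · simp [hJ0]
  · exact tendsto_atTop_mono (fun s => le_self_add) tendsto_id
  · intro s
    refine le_add_left (NNReal.le_toNNReal_of_coe_le ?_)
    simpa [hh] using hJlow s s.2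

/-- A family of numbers `w i`, each attached to a size `r i`, is dominated by a `K∞` function of the
size as soon as it is bounded on bounded sizes and small for small sizes. -/
theorem exists_isKInf_bound {ι : Type*} (w r : ι → ℝ≥0)
    (hb : ∀ R, ∃ B, ∀ i, r i ≤ R → w i ≤ B)
    (h0 : ∀ ε, 0 < ε → ∃ δ, 0 < δ ∧ ∀ i, r i ≤ δ → w i ≤ ε) :
    ∃ a, IsKInf a ∧ ∀ i, w i ≤ a (r i) := by
  have hbdd : ∀ R, BddAbove (w '' {i | r i ≤ R}) := fun R => by
    obtain ⟨B, hB⟩ := hb R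
    exact ⟨B, by rintro _ ⟨i, hi, rfl⟩; exact hB i hi⟩
  obtain ⟨a, ha, hle⟩ := exists_isKInf_ge_of_monotone (fun s => sSup (w '' {i | r i ≤ s}))
    (by
      intro s t hst
      refine csSup_le' ?_
      rintro _ ⟨i, hi, rfl⟩
      exact le_csSup (hbdd t) ⟨i, le_trans hi hst, rfl⟩)
    (by
      refine tendsto_order.2 ⟨fun y hy => absurd hy not_lt_zero, fun ε hε => ?_⟩
      obtain ⟨δ, hδ, h⟩ := h0 (ε / 2) (half_pos hε)
      filter_upwards [Iic_mem_nhds hδ] with s hs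
      refine lt_of_le_of_lt (csSup_le' ?_) (NNReal.half_lt_self hε.ne')
      rintro _ ⟨i, hi, rfl⟩
      exact h i (le_trans hi hs))
  exact ⟨a, ha, fun i => (le_csSup (hbdd (r i)) ⟨i, le_refl (r i), rfl⟩).trans (hle _)⟩

/-- Domination of countably many families at once, by one `K∞` function and a rescaling `β` of the
size that depends on the family. The `K∞` function has to control the `n`-th family only where the
size is at least `n` or the value at most `2⁻ⁿ`; the remaining part is bounded and has sizes bounded
away from `0`, so that a large `β n` takes care of it. -/
theorem exists_isKInf_isKPlus_bound {ι : Type*} (v : ℕ → ι → ℝ≥0) (r : ι → ℝ≥0)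
    (hb : ∀ n R, ∃ B, ∀ i, r i ≤ R → v n i ≤ B)
    (h0 : ∀ n ε, 0 < ε → ∃ δ, 0 < δ ∧ ∀ i, r i ≤ δ → v n i ≤ ε) :
    ∃ a β, IsKInf a ∧ IsKPlus β ∧ ∀ (n : ℕ) i, v n i ≤ a (β n * r i) := by
  have hhalf : (1 / 2 : ℝ≥0) < 1 := NNReal.half_lt_self one_ne_zero
  have hpow : ∀ n : ℕ, (0 : ℝ≥0) < (1 / 2) ^ n := fun n => by positivity
  obtain ⟨a, ha, hle⟩ := exists_isKInf_bound
    (ι := {q : ℕ × ι // (q.1 : ℝ≥0) ≤ r q.2 ∨ v q.1 q.2 ≤ (1 / 2) ^ q.1})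
    (fun q => v q.1.1 q.1.2) (fun q => r q.1.2)
    (by
      intro R
      choose B hB using fun n => hb n R
      refine ⟨max 1 ((Finset.range (⌈R⌉₊ + 1)).sup B), ?_⟩
      rintro ⟨⟨n, i⟩, hq | hq⟩ hi
      · refine le_max_of_le_right ((hB n i hi).trans (Finset.le_sup ?_))
        have h1 : (n : ℝ≥0) ≤ ⌈R⌉₊ := (hq.trans hi).trans (Nat.le_ceil R)
        exact Finset.mem_range_succ_iff.2 (by exact_mod_cast h1)
      · exact le_max_of_le_left (hq.trans (pow_le_one₀ zero_le hhalf.le)))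
    (by
      intro ε hε
      obtain ⟨N, hN⟩ := exists_pow_lt_of_lt_one hε hhalf
      choose δ hδ hv using fun n => h0 n ε hε
      obtain ⟨η, hη, hη1, hηδ⟩ := exists_pos_le_of_lt (half_pos one_pos) δ hδ (N + 1)
      refine ⟨η, hη, ?_⟩
      rintro ⟨⟨n, i⟩, hq⟩ hi
      by_cases hn : n < N + 1
      · exact hv n i (hi.trans (hηδ n hn))
      · have hpowN : ((1 / 2) ^ n : ℝ≥0) ≤ ε :=
          (pow_le_pow_of_le_one zero_le hhalf.le (by omega)).trans hN.le
        rcases hq with hq | hq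
        · have h1 : (n : ℝ≥0) < 1 := (hq.trans (hi.trans hη1)).trans_lt hhalf
          have h2 : n < 1 := by exact_mod_cast h1
          omega
        · exact hq.trans hpowN)
  choose B hB using fun n : ℕ => hb n n
  choose δ hδ hv using fun n : ℕ => h0 n ((1 / 2) ^ n) (hpow n)
  choose s hs using fun n => ha.exists_le (B n)
  obtain ⟨β, hβ, hβe⟩ := exists_isKPlus_eq (fun n => max 1 (s n / δ n)) fun n => by positivity
  refine ⟨a, β, ha, hβ, fun n i => ?_⟩
  rw [hβe]
  by_cases hq : (n : ℝ≥0) ≤ r i ∨ v n i ≤ (1 / 2) ^ n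
  · exact (hle ⟨(n, i), hq⟩).trans (ha.strictMono.monotone (le_mul_of_one_le_left zero_le (le_max_left _ _)))
  · push Not at hq
    have hδi : δ n < r i := not_le.1 fun h => (hv n i h).not_gt hq.2
    refine (hB n i hq.1.le).trans ((hs n).trans (ha.strictMono.monotone ?_))
    calc s n = s n / δ n * δ n := (div_mul_cancel₀ _ (hδ n).ne').symm
      _ ≤ _ := mul_le_mul (le_max_right _ _) hδi.le zero_le zero_le

/-! ### Gains and fading sequences of gains -/

theorem IsKL.continuous_left {σ : ℝ≥0 → ℝ≥0 → ℝ≥0} (hσ : IsKL σ) (t : ℝ≥0) :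
    Continuous fun s => σ s t :=
  hσ.continuous.comp (continuous_id.prodMk continuous_const)

theorem IsKL.mono {σ : ℝ≥0 → ℝ≥0 → ℝ≥0} (hσ : IsKL σ) {s s' t t' : ℝ≥0} (hs : s ≤ s')
    (ht : t' ≤ t) : σ s t ≤ σ s' t' :=
  ((hσ.strictMono t).monotone hs).trans (hσ.antitone s' ht)

/-- Continuous monotone functions on the half-line that vanish at `0`: the gains that compose
along trajectories. Unlike class `K∞`, they need be neither strictly monotone nor unbounded. -/
structure IsGain (w : ℝ≥0 → ℝ≥0) : Prop where
  continuous : Continuous w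
  monotone : Monotone w
  map_zero : w 0 = 0

theorem IsKInf.isGain {a : ℝ≥0 → ℝ≥0} (ha : IsKInf a) : IsGain a :=
  ⟨ha.continuous, ha.strictMono.monotone, ha.map_zero⟩

theorem IsKL.isGain {σ : ℝ≥0 → ℝ≥0 → ℝ≥0} (hσ : IsKL σ) (t : ℝ≥0) : IsGain fun s => σ s t :=
  ⟨hσ.continuous_left t, (hσ.strictMono t).monotone, hσ.map_zero t⟩

theorem IsGain.comp {v w : ℝ≥0 → ℝ≥0} (hv : IsGain v) (hw : IsGain w) :
    IsGain fun s => v (w s) :=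
  ⟨hv.continuous.comp hw.continuous, hv.monotone.comp hw.monotone, by
    rw [hw.map_zero, hv.map_zero]⟩

theorem IsGain.add {v w : ℝ≥0 → ℝ≥0} (hv : IsGain v) (hw : IsGain w) :
    IsGain fun s => v s + w s :=
  ⟨hv.continuous.add hw.continuous, hv.monotone.add hw.monotone, by
    rw [hw.map_zero, hv.map_zero, add_zero]⟩

theorem isGain_const_mul (c : ℝ≥0) : IsGain fun s => c * s :=
  ⟨by fun_prop, fun _ _ h => mul_le_mul_right h c, mul_zero c⟩

theorem isGain_id : IsGain fun s => s := IsKInf.id.isGain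

theorem IsGain.exists_pos {w : ℝ≥0 → ℝ≥0} (hw : IsGain w) {ε : ℝ≥0} (hε : 0 < ε) :
    ∃ δ, 0 < δ ∧ ∀ s ≤ δ, w s ≤ ε := by
  have hlt : ∀ᶠ s in 𝓝 (0 : ℝ≥0), w s < ε := (hw.continuous.tendsto' 0 0 hw.map_zero).eventually_lt_const hε
  obtain ⟨δ, hδ, h⟩ := Metric.eventually_nhds_iff.1 hlt
  refine ⟨(δ / 2).toNNReal, Real.toNNReal_pos.2 (half_pos hδ), fun s hs => (h ?_).le⟩
  have : (s : ℝ) ≤ δ / 2 := by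
    simpa [Real.coe_toNNReal _ (half_pos hδ).le] using NNReal.coe_le_coe.2 hs
  rw [NNReal.dist_eq, NNReal.coe_zero, sub_zero, NNReal.abs_eq]
  linarith

theorem exists_forall_isGain_le (w : ℕ → ℝ≥0 → ℝ≥0) (hw : ∀ n, IsGain (w n)) {ε : ℝ≥0}
    (hε : 0 < ε) (N : ℕ) : ∃ δ, 0 < δ ∧ δ ≤ 1 ∧ ∀ n < N, ∀ s ≤ δ, w n s ≤ ε := by
  choose δ hδ h using fun n => (hw n).exists_pos hε
  obtain ⟨η, hη, hη1, hle⟩ := exists_pos_le_of_lt one_pos δ hδ N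
  exact ⟨η, hη, hη1, fun n hn s hs => h n s (hs.trans (hle n hn))⟩

theorem exists_half_pow_le {ε : ℝ≥0} (hε : 0 < ε) (N : ℕ) :
    ∃ M, N ≤ M ∧ ∀ m, M ≤ m → ((1 / 2) ^ m : ℝ≥0) ≤ ε := by
  have hhalf : (1 / 2 : ℝ≥0) < 1 := NNReal.half_lt_self one_ne_zero
  obtain ⟨M, hM⟩ := exists_pow_lt_of_lt_one hε hhalf
  exact ⟨max N M, le_max_left _ _, fun m hm =>
    (pow_le_pow_of_le_one zero_le hhalf.le ((le_max_right _ _).trans hm)).trans hM.le⟩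

/-- A sequence of gains whose values at every point are bounded and tend to `0`, and which are small
at `0` uniformly. -/
structure IsFading (φ : ℕ → ℝ≥0 → ℝ≥0) : Prop where
  monotone : ∀ t, Monotone (φ t)
  bounded : ∀ s, ∃ B, ∀ t, φ t s ≤ B
  small : ∀ ε, 0 < ε → ∃ δ, 0 < δ ∧ ∀ t, φ t δ ≤ ε
  vanishing : ∀ ε, 0 < ε → ∀ s, ∃ N, ∀ t, N ≤ t → φ t s ≤ ε

/-- A sequence of gains is fading if the `t`-th one is at most `2⁻ᵗ` on `[0, t]`; no uniformity for
large arguments is needed. -/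
theorem isFading_of_le_pow {φ : ℕ → ℝ≥0 → ℝ≥0} (hφ : ∀ t, IsGain (φ t))
    (h : ∀ (t : ℕ) (s : ℝ≥0), s ≤ t → φ t s ≤ (1 / 2) ^ t) : IsFading φ := by
  have hlarge : ∀ ε : ℝ≥0, 0 < ε → ∃ N, ∀ (t : ℕ) (s : ℝ≥0), N ≤ t → s ≤ t → φ t s ≤ ε := by
    intro ε hε
    obtain ⟨N, -, hN⟩ := exists_half_pow_le hε 0
    exact ⟨N, fun t s ht hs => (h t s hs).trans (hN t ht)⟩
  have hvan : ∀ ε : ℝ≥0, 0 < ε → ∀ s, ∃ N, ∀ t, N ≤ t → φ t s ≤ ε := by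
    intro ε hε s
    obtain ⟨N, hN⟩ := hlarge ε hε
    refine ⟨max N ⌈s⌉₊, fun t ht => hN t s ((le_max_left _ _).trans ht) ((Nat.le_ceil s).trans ?_)⟩
    exact_mod_cast (le_max_right _ _).trans ht
  refine ⟨fun t => (hφ t).monotone, fun s => ?_, fun ε hε => ?_, hvan⟩
  · obtain ⟨N, hN⟩ := hvan 1 one_pos s
    refine ⟨max 1 ((Finset.range N).sup fun t => φ t s), fun t => ?_⟩
    rcases le_or_gt N t with ht | ht
    · exact le_max_of_le_left (hN t ht)
    · exact le_max_of_le_right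
        (Finset.le_sup (f := fun t => φ t s) (Finset.mem_range.2 ht))
  · obtain ⟨N, hN⟩ := hlarge ε hε
    obtain ⟨δ, hδ, hδ1, hle⟩ := exists_forall_isGain_le φ hφ hε (N + 1)
    refine ⟨δ, hδ, fun t => ?_⟩
    rcases lt_or_ge t (N + 1) with ht | ht
    · exact hle t ht δ le_rfl
    · refine hN t δ (by omega) (hδ1.trans ?_)
      exact_mod_cast (by omega : 1 ≤ t)

theorem IsFading.comp {φ : ℕ → ℝ≥0 → ℝ≥0} (hφ : IsFading φ) {w : ℝ≥0 → ℝ≥0} (hw : IsGain w) :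
    IsFading fun t s => w (φ t s) := by
  refine ⟨fun t => hw.monotone.comp (hφ.monotone t), fun s => ?_, fun ε hε => ?_, fun ε hε s => ?_⟩
  · obtain ⟨B, hB⟩ := hφ.bounded s
    exact ⟨w B, fun t => hw.monotone (hB t)⟩
  · obtain ⟨η, hη, h⟩ := hw.exists_pos hε
    obtain ⟨δ, hδ, hle⟩ := hφ.small η hη
    exact ⟨δ, hδ, fun t => h _ (hle t)⟩
  · obtain ⟨η, hη, h⟩ := hw.exists_pos hε
    obtain ⟨N, hN⟩ := hφ.vanishing η hη s
    exact ⟨N, fun t ht => h _ (hN t ht)⟩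

/-- Any sequence of gains becomes fading after multiplication with a small enough weight. -/
theorem exists_weight_isFading (κ : ℕ → ℝ≥0 → ℝ≥0) (hκ : ∀ t, IsGain (κ t)) (c : ℕ → ℝ≥0) :
    ∃ μ, IsKPlus μ ∧ (∀ t : ℕ, μ t ≤ 1) ∧ IsFading fun t s => c t * (μ t * κ t s) := by
  have hpow : ∀ t : ℕ, ((1 / 2) ^ t : ℝ≥0) ≤ 1 := fun t =>
    pow_le_one₀ zero_le (NNReal.half_lt_self one_ne_zero).le
  obtain ⟨μ, hμ, hμe⟩ := exists_isKPlus_eq (fun t => (1 / 2) ^ t / ((1 + c t) * (1 + κ t t)))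
    fun t => by positivity
  refine ⟨μ, hμ, fun t => ?_, isFading_of_le_pow (fun t => ?_) fun t s hs => ?_⟩
  · rw [hμe]
    refine div_le_one_of_le₀ ((hpow t).trans ?_) zero_le
    exact one_le_mul (le_add_right le_rfl) (le_add_right le_rfl)
  · exact (isGain_const_mul _).comp ((isGain_const_mul _).comp (hκ t))
  · rw [hμe]
    calc c t * ((1 / 2) ^ t / ((1 + c t) * (1 + κ t t)) * κ t s)
        ≤ (1 + c t) * ((1 / 2) ^ t / ((1 + c t) * (1 + κ t t)) * (1 + κ t t)) := by
          gcongr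
          · exact le_add_left le_rfl
          · exact ((hκ t).monotone hs).trans (le_add_left le_rfl)
      _ = (1 / 2) ^ t := by field_simp

/-! ### Growth of trajectories -/

section

variable {D X U Y : Type*}
  [NormedAddCommGroup X] [NormedAddCommGroup U] [NormedAddCommGroup Y]

/-- The gain that bounds the state at time `t` by the initial state, whatever the initial time
`t₀ ≤ t`, when the step at time `t` is bounded by the gain `ω t`. Iterating `s ↦ s + ω t s` instead
of `ω t` makes the bounds increase in `t`, so that one gain serves all initial times. -/
def growthGain (ω : ℕ → ℝ≥0 → ℝ≥0) : ℕ → ℝ≥0 → ℝ≥0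
  | 0, s => s
  | t + 1, s => growthGain ω t s + ω t (growthGain ω t s)

theorem isGain_growthGain {ω : ℕ → ℝ≥0 → ℝ≥0} (hω : ∀ t, IsGain (ω t)) (t : ℕ) :
    IsGain (growthGain ω t) := by
  induction t with
  | zero => exact isGain_id
  | succ t ih => exact ih.add ((hω t).comp ih)

theorem le_growthGain (ω : ℕ → ℝ≥0 → ℝ≥0) (t : ℕ) (s : ℝ≥0) : s ≤ growthGain ω t s := by
  induction t with
  | zero => exact le_rfl
  | succ t ih => exact le_add_right ih

theorem IsSolution.nnnorm_le_growthGain {ω : ℕ → ℝ≥0 → ℝ≥0} (hω : ∀ t, IsGain (ω t))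
    {g : ℕ → X → X} (hg : ∀ t x, ‖g t x‖₊ ≤ ω t ‖x‖₊) {t₀ : ℕ} {x₀ : X} {x : ℕ → X}
    (h : IsSolution g t₀ x₀ x) {t : ℕ} (ht : t₀ ≤ t) : ‖x t‖₊ ≤ growthGain ω t ‖x₀‖₊ := by
  induction t, ht using Nat.le_induction with
  | base => rw [h.1]; exact le_growthGain ω t₀ _
  | succ t ht ih =>
    rw [h.2 t ht]
    exact (hg t (x t)).trans (le_add_left ((hω t).monotone ih))

/-! ### From input-to-output stability to the stability margin -/

theorem IsIOS.hasSupGainEstimate {f : ℕ → D → X → U → X} {H : ℕ → X → Y} (h : IsIOS f H) :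
    HasSupGainEstimate f H := by
  obtain ⟨σ, β, γ, ρ, hσ, hβ, hγ, hρ, hest⟩ := h
  have hgain : ∀ n : ℕ, IsGain fun s => σ (β n * ρ (γ n * s)) 0 := fun n =>
    (hσ.isGain 0).comp ((isGain_const_mul _).comp (hρ.isGain.comp (isGain_const_mul _)))
  obtain ⟨ζ, δ, hζ, hδ, hle⟩ := exists_isKInf_isKPlus_bound
    (fun (n : ℕ) s => σ (β n * ρ (γ n * s)) 0) (fun s => s)
    (fun n R => ⟨_, fun s hs => (hgain n).monotone hs⟩) (fun n ε hε => (hgain n).exists_pos hε)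
  refine ⟨ζ, β, δ, σ, hζ, hβ, hδ, hσ, fun t₀ x₀ d u x hx t ht => (hest u t₀ x₀ d x hx t ht).trans ?_⟩
  refine max_le_max le_rfl (Finset.sup_mono_fun fun τ _ => ?_)
  exact (hσ.antitone _ zero_le).trans (hle τ ‖u τ‖₊)

/-- The feedback perturbation `p(t) ‖x‖ d'` with a rapidly decreasing `p` leaves the output stable:
along trajectories it is bounded by a fading function of the initial state. Attractivity comes from
restarting the estimate at a time from which the perturbation is negligible. -/
theorem HasSupGainEstimate.hasStabilityMargin [NormedSpace ℝ U] {f : ℕ → D → X → U → X} {H : ℕ → X → Y}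
    (hA : HypA1 f) (h : HasSupGainEstimate f H) : HasStabilityMargin f H := by
  obtain ⟨a, b, ha, hb, hf⟩ := hA
  obtain ⟨ζ, β, δ, σ, hζ, hβ, hδ, hσ, hest⟩ := h
  set ω : ℕ → ℝ≥0 → ℝ≥0 := fun t s => a (b t * s) + a (b t * s) with hωdef
  have hω : ∀ t, IsGain (ω t) := fun t =>
    (ha.isGain.comp (isGain_const_mul _)).add (ha.isGain.comp (isGain_const_mul _))
  set κ := growthGain ω
  have hκ : ∀ t, IsGain (κ t) := isGain_growthGain hω
  obtain ⟨p, hp, hp1, hfade⟩ := exists_weight_isFading κ hκ fun t => δ t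
  have hφ := hfade.comp hζ.isGain
  set φ : ℕ → ℝ≥0 → ℝ≥0 := fun t s => ζ (δ t * (p t * κ t s))
  refine ⟨fun s => s, p, IsKInf.id, hp, ?_⟩
  have hu : ∀ (t : ℕ) (x : X) (e : Metric.closedBall (0 : U) 1),
      ‖((p t * ‖x‖₊ : ℝ≥0) : ℝ) • (e : U)‖₊ ≤ p t * ‖x‖₊ := by
    intro t x e
    have he : ‖(e : U)‖₊ ≤ 1 := by
      have := e.2
      rw [mem_closedBall_zero_iff] at this
      exact_mod_cast this
    rw [nnnorm_smul, NNReal.nnnorm_eq]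
    exact mul_le_of_le_one_right zero_le he
  have hsol : ∀ {t₀ x₀} {e : ℕ → D × Metric.closedBall (0 : U) 1} {x : ℕ → X},
      IsSolution (fun s => feedbackDynamics f p (fun s => s) s (e s)) t₀ x₀ x →
      ∀ t, t₀ ≤ t → ‖x t‖₊ ≤ κ t ‖x₀‖₊ := by
    intro t₀ x₀ e x hx t ht
    refine hx.nnnorm_le_growthGain hω (fun t y => (hf t y _ _).trans ?_) ht
    refine add_le_add_right (ha.strictMono.monotone (mul_le_mul_right ((hu t y _).trans ?_) _)) _
    exact mul_le_of_le_one_left zero_le (hp1 t)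
  have hmain : ∀ {t₀ x₀} {e : ℕ → D × Metric.closedBall (0 : U) 1} {x : ℕ → X},
      IsSolution (fun s => feedbackDynamics f p (fun s => s) s (e s)) t₀ x₀ x →
      ∀ t₁ t B, t₀ ≤ t₁ → t₁ ≤ t → (∀ τ, t₁ ≤ τ → φ τ ‖x₀‖₊ ≤ B) →
        ‖H t (x t)‖₊ ≤ max (σ (β t₁ * ‖x t₁‖₊) ((t - t₁ : ℕ) : ℝ≥0)) B := by
    intro t₀ x₀ e x hx t₁ t B ht₁ ht hB
    refine (hest t₁ (x t₁) (fun s => (e s).1)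
      (fun s => ((p s * ‖x s‖₊ : ℝ≥0) : ℝ) • ((e s).2 : U)) x ⟨rfl, fun s hs => hx.2 s (ht₁.trans hs)⟩
      t ht).trans (max_le_max le_rfl (Finset.sup_le fun τ hτ => ?_))
    have hτ' := (Finset.mem_Icc.1 hτ).1
    refine le_trans (hζ.strictMono.monotone (mul_le_mul_right ?_ _)) (hB τ hτ')
    exact (hu τ _ _).trans (mul_le_mul_right (hsol hx τ (ht₁.trans hτ')) _)
  have hmain' : ∀ {t₀ x₀} {e : ℕ → D × Metric.closedBall (0 : U) 1} {x : ℕ → X},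
      IsSolution (fun s => feedbackDynamics f p (fun s => s) s (e s)) t₀ x₀ x →
      ∀ t B, t₀ ≤ t → (∀ τ, φ τ ‖x₀‖₊ ≤ B) →
        ‖H t (x t)‖₊ ≤ max (σ (β t₀ * ‖x₀‖₊) 0) B := by
    intro t₀ x₀ e x hx t B ht hB
    refine (hmain hx t₀ t B le_rfl ht fun τ _ => hB τ).trans (max_le_max ?_ le_rfl)
    rw [hx.1]
    exact hσ.antitone _ zero_le
  refine ⟨fun ε hε T => ?_, fun ε hε T => ?_, fun ε hε T R hR => ?_⟩
  · lift ε to ℝ≥0 using hε.le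
    obtain ⟨B, hB⟩ := hφ.bounded ε
    refine ⟨(max ((Finset.range (T + 1)).sup fun t => σ (β t * ε) 0) B : ℝ≥0), ?_⟩
    rintro _ ⟨t₀, x₀, e, x, t, ht₀, hx₀, hx, ht, rfl⟩
    have hx₀' : ‖x₀‖₊ ≤ ε := hx₀
    refine NNReal.coe_le_coe.2 ((hmain' hx t B ht fun τ => (hφ.monotone τ hx₀').trans (hB τ)).trans
      (max_le_max ?_ le_rfl))
    exact (hσ.mono (mul_le_mul_right hx₀' _) le_rfl).trans
      (Finset.le_sup (f := fun t : ℕ => σ (β t * ε) 0) (Finset.mem_range_succ_iff.2 ht₀))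
  · lift ε to ℝ≥0 using hε.le
    obtain ⟨δ₁, hδ₁, h₁⟩ := hφ.small ε hε
    obtain ⟨δ₂, hδ₂, -, h₂⟩ := exists_forall_isGain_le (fun (t : ℕ) s => σ (β t * s) 0)
      (fun t => (hσ.isGain 0).comp (isGain_const_mul _)) (ε := ε) hε (T + 1)
    refine ⟨(min δ₁ δ₂ : ℝ≥0), lt_min hδ₁ hδ₂, fun t₀ x₀ hx₀ ht₀ e x hx t ht => ?_⟩
    have hx₀' : ‖x₀‖₊ ≤ min δ₁ δ₂ := hx₀
    exact NNReal.coe_le_coe.2 ((hmain' hx t ε ht fun τ =>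
      (hφ.monotone τ (hx₀'.trans (min_le_left _ _))).trans (h₁ τ)).trans
      (max_le (h₂ t₀ (Nat.lt_succ_of_le ht₀) _ (hx₀'.trans (min_le_right _ _))) le_rfl))
  · lift ε to ℝ≥0 using hε.le
    lift R to ℝ≥0 using hR
    obtain ⟨N, hN⟩ := hφ.vanishing ε hε R
    set t₁ := max N T
    have hlim : Tendsto (fun k : ℕ => σ (β t₁ * κ t₁ R) (k : ℝ≥0)) atTop (𝓝 0) :=
      (hσ.tendsto_zero _).comp tendsto_natCast_atTop_atTop
    obtain ⟨k, hk⟩ := (hlim.eventually_le_const (show (0 : ℝ≥0) < ε from hε)).exists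
    refine ⟨t₁ + k, fun t₀ x₀ hx₀ ht₀ e x hx t ht => ?_⟩
    have hx₀' : ‖x₀‖₊ ≤ R := hx₀
    have ht₁ : t₀ ≤ t₁ := ht₀.trans (le_max_right _ _)
    refine NNReal.coe_le_coe.2 ((hmain hx t₁ t ε ht₁ (by omega) fun τ hτ =>
      (hφ.monotone τ hx₀').trans (hN τ ((le_max_left _ _).trans hτ))).trans (max_le ?_ le_rfl))
    refine (hσ.mono (mul_le_mul_right ((hsol hx t₁ ht₁).trans ((hκ t₁).monotone hx₀')) _) ?_).trans hk
    exact_mod_cast (by omega : k ≤ t - t₁)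

end

/-! ### A converse Lyapunov construction -/

section

variable {E X : Type*}

/-- The worst value of `Z` after `k` steps from `x` at time `t`, over all disturbances, by dynamic
programming. Over an empty set of disturbances it is `0` for `k > 0`. -/
noncomputable def worstValue (F : ℕ → E → X → X) (Z : ℕ → X → ℝ≥0) : ℕ → ℕ → X → ℝ≥0∞
  | 0, t, x => Z t x
  | k + 1, t, x => ⨆ e, worstValue F Z k (t + 1) (F t e x)

/-- The thresholds `1 / (m + 1)`. -/
noncomputable def threshold (m : ℕ) : ℝ≥0 := 1 / (m + 1)

theorem threshold_pos (m : ℕ) : 0 < threshold m := by unfold threshold; positivity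

theorem threshold_antitone : Antitone threshold := fun m n h => by
  unfold threshold
  gcongr

/-- The supremum over `k` of the excess of the worst value after `k` steps over the `m`-th
threshold, with the weights `2 ^ k`. Thanks to the threshold only finitely many `k` contribute. -/
noncomputable def excess (F : ℕ → E → X → X) (Z : ℕ → X → ℝ≥0) (m t : ℕ) (x : X) : ℝ≥0∞ :=
  ⨆ k : ℕ, 2 ^ k * (worstValue F Z k t x - threshold m)

/-- The Lyapunov function before its values are known to be finite: the supremum of the excesses
over all thresholds, with weights `c`. -/
noncomputable def valueSup (F : ℕ → E → X → X) (Z : ℕ → X → ℝ≥0) (c : ℕ → ℝ≥0) (t : ℕ) (x : X) :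
    ℝ≥0∞ :=
  ⨆ m : ℕ, c m * excess F Z m t x

theorem two_mul_valueSup_le (F : ℕ → E → X → X) (Z : ℕ → X → ℝ≥0) (c : ℕ → ℝ≥0) (t : ℕ) (e : E)
    (x : X) : 2 * valueSup F Z c (t + 1) (F t e x) ≤ valueSup F Z c t x := by
  rw [valueSup, ENNReal.mul_iSup]
  refine iSup_mono fun m => ?_
  rw [mul_left_comm]
  gcongr
  rw [excess, ENNReal.mul_iSup]
  refine iSup_le fun k => le_trans ?_ (le_iSup _ (k + 1))
  rw [← mul_assoc, ← pow_succ']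
  gcongr
  exact le_iSup (fun e => worstValue F Z k (t + 1) (F t e x)) e

theorem le_valueSup (F : ℕ → E → X → X) (Z : ℕ → X → ℝ≥0) (c : ℕ → ℝ≥0) (t m : ℕ) (x : X) :
    ((c m * (Z t x - threshold m) : ℝ≥0) : ℝ≥0∞) ≤ valueSup F Z c t x := by
  refine le_trans ?_ (le_iSup _ m)
  rw [ENNReal.coe_mul, ENNReal.coe_sub]
  gcongr
  refine le_trans ?_ (le_iSup _ 0)
  simp [worstValue]

variable [NormedAddCommGroup X] {F : ℕ → E → X → X} {Z : ℕ → X → ℝ≥0}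

/-- Robust global asymptotic stability of the quantity `Z`, in terms of its worst values. -/
structure WorstValueDecays (F : ℕ → E → X → X) (Z : ℕ → X → ℝ≥0) : Prop where
  bounded : ∀ N : ℕ, ∃ B : ℝ≥0, ∀ k t x, t ≤ N → ‖x‖₊ ≤ N → worstValue F Z k t x ≤ B
  small : ∀ (N : ℕ) (ε : ℝ≥0), 0 < ε → ∃ δ : ℝ≥0, 0 < δ ∧
    ∀ k t x, t ≤ N → ‖x‖₊ ≤ δ → worstValue F Z k t x ≤ ε
  vanishing : ∀ (N : ℕ) (ε : ℝ≥0), 0 < ε → ∃ K : ℕ, ∀ k t x, K ≤ k → t ≤ N → ‖x‖₊ ≤ N →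
    worstValue F Z k t x ≤ ε

/-- Weights for which the `m`-th term of `valueSup` is at most `2⁻ᵐ` for times and states of size at
most `m`. They make the supremum finite, and only finitely many terms matter for its behaviour on
bounded sets. -/
structure IsExcessWeight (F : ℕ → E → X → X) (Z : ℕ → X → ℝ≥0) (c : ℕ → ℝ≥0) : Prop where
  pos : ∀ m, 0 < c m
  le_one : ∀ m, c m ≤ 1
  mul_excess_le : ∀ (m t : ℕ) (x : X), t ≤ m → ‖x‖₊ ≤ m →
    c m * excess F Z m t x ≤ ((1 / 2) ^ m : ℝ≥0)

theorem WorstValueDecays.exists_excess_le (h : WorstValueDecays F Z) (m N : ℕ) :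
    ∃ B : ℝ≥0, ∀ t x, t ≤ N → ‖x‖₊ ≤ N → excess F Z m t x ≤ B := by
  obtain ⟨B, hB⟩ := h.bounded N
  obtain ⟨K, hK⟩ := h.vanishing N (threshold m) (threshold_pos m)
  refine ⟨2 ^ K * B, fun t x ht hx => iSup_le fun k => ?_⟩
  rcases le_total K k with hk | hk
  · rw [tsub_eq_zero_of_le (hK k t x hk ht hx), mul_zero]
    exact zero_le
  · push_cast
    gcongr
    · exact one_le_two
    · exact tsub_le_self.trans (hB k t x ht hx)

theorem WorstValueDecays.exists_isExcessWeight (h : WorstValueDecays F Z) :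
    ∃ c : ℕ → ℝ≥0, IsExcessWeight F Z c := by
  choose B hB using fun m => h.exists_excess_le m m
  refine ⟨fun m => (1 / 2) ^ m / (1 + B m), fun m => by positivity, fun m => ?_, fun m t x ht hx => ?_⟩
  · refine div_le_one_of_le₀ (le_trans ?_ (le_add_right le_rfl)) zero_le
    exact pow_le_one₀ zero_le (NNReal.half_lt_self one_ne_zero).le
  · calc _ ≤ (((1 / 2) ^ m / (1 + B m) : ℝ≥0) : ℝ≥0∞) * ((1 + B m : ℝ≥0) : ℝ≥0∞) := by
          gcongr
          exact (hB m t x ht hx).trans (ENNReal.coe_le_coe.2 (le_add_left le_rfl))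
      _ = _ := by
          rw [← ENNReal.coe_mul, div_mul_cancel₀]
          positivity

theorem WorstValueDecays.exists_valueSup_le (h : WorstValueDecays F Z) {c : ℕ → ℝ≥0}
    (hc : IsExcessWeight F Z c) (N : ℕ) :
    ∃ B : ℝ≥0, ∀ t x, t ≤ N → ‖x‖₊ ≤ N → valueSup F Z c t x ≤ B := by
  choose B hB using fun m => h.exists_excess_le m N
  refine ⟨max 1 ((Finset.range N).sup fun m => c m * B m), fun t x ht hx => iSup_le fun m => ?_⟩
  rcases lt_or_ge m N with hm | hm
  · refine le_trans ?_ (ENNReal.coe_le_coe.2 (le_max_of_le_right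
      (Finset.le_sup (f := fun m => c m * B m) (Finset.mem_range.2 hm))))
    rw [ENNReal.coe_mul]
    gcongr
    exact hB m t x ht hx
  · refine (hc.mul_excess_le m t x (ht.trans hm) (hx.trans (by exact_mod_cast hm))).trans
      (ENNReal.coe_le_coe.2 (le_max_of_le_left ?_))
    exact pow_le_one₀ zero_le (NNReal.half_lt_self one_ne_zero).le

theorem WorstValueDecays.valueSup_small (h : WorstValueDecays F Z) {c : ℕ → ℝ≥0}
    (hc : IsExcessWeight F Z c) (N : ℕ) {ε : ℝ≥0} (hε : 0 < ε) :
    ∃ δ : ℝ≥0, 0 < δ ∧ ∀ t x, t ≤ N → ‖x‖₊ ≤ δ → valueSup F Z c t x ≤ ε := by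
  obtain ⟨M, hNM, hM⟩ := exists_half_pow_le hε (N + 1)
  obtain ⟨δ, hδ, hδW⟩ := h.small N (threshold M) (threshold_pos M)
  refine ⟨min 1 δ, lt_min one_pos hδ, fun t x ht hx => iSup_le fun m => ?_⟩
  rcases lt_or_ge m M with hm | hm
  · have : excess F Z m t x = 0 := by
      refine le_antisymm (iSup_le fun k => ?_) zero_le
      rw [tsub_eq_zero_of_le, mul_zero]
      exact (hδW k t x ht (hx.trans (min_le_right _ _))).trans
        (ENNReal.coe_le_coe.2 (threshold_antitone hm.le))
    rw [this, mul_zero]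
    exact zero_le
  · refine (hc.mul_excess_le m t x (by omega) ((hx.trans (min_le_left _ _)).trans ?_)).trans
      (ENNReal.coe_le_coe.2 (hM m hm))
    exact_mod_cast (by omega : 1 ≤ m)

/-- Uniform continuity on bounded sets of a function with values in `[0, +∞]`, uniform over bounded
sets of times. It is stated additively, so that infinite values need no separate treatment. -/
def UniformOnBounded (G : ℕ → X → ℝ≥0∞) : Prop :=
  ∀ (N : ℕ) (ε : ℝ≥0), 0 < ε → ∃ δ : ℝ≥0, 0 < δ ∧ ∀ t x y, t ≤ N → ‖x‖₊ ≤ N → ‖y‖₊ ≤ N →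
    ‖x - y‖₊ < δ → G t x ≤ G t y + ε

/-- On bounded sets of times and points, the dynamics is bounded and uniformly continuous in the
state, uniformly over the disturbances. -/
structure RobustlyUniformOnBounded (F : ℕ → E → X → X) : Prop where
  bounded : ∀ N : ℕ, ∃ B : ℕ, ∀ t e x, t ≤ N → ‖x‖₊ ≤ N → ‖F t e x‖₊ ≤ B
  uniform : ∀ (N : ℕ) (ε : ℝ≥0), 0 < ε → ∃ δ : ℝ≥0, 0 < δ ∧ ∀ t e x y, t ≤ N → ‖x‖₊ ≤ N →
    ‖y‖₊ ≤ N → ‖x - y‖₊ < δ → ‖F t e x - F t e y‖₊ < ε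

theorem RobustlyUniformOnBounded.worstValue (hF : RobustlyUniformOnBounded F)
    (hZ : UniformOnBounded fun t x => (Z t x : ℝ≥0∞)) (k : ℕ) :
    UniformOnBounded (worstValue F Z k) := by
  induction k with
  | zero => exact hZ
  | succ k ih =>
    intro N ε hε
    obtain ⟨B, hB⟩ := hF.bounded N
    obtain ⟨η, hη, h⟩ := ih (max B (N + 1)) ε hε
    obtain ⟨δ, hδ, h'⟩ := hF.uniform N η hη
    have hle : ∀ t e x, t ≤ N → ‖x‖₊ ≤ N → ‖F t e x‖₊ ≤ ((max B (N + 1) : ℕ) : ℝ≥0) :=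
      fun t e x ht hx => (hB t e x ht hx).trans (by exact_mod_cast le_max_left _ _)
    refine ⟨δ, hδ, fun t x y ht hx hy hxy => iSup_le fun e => ?_⟩
    refine (h (t + 1) _ _ (by omega) (hle t e x ht hx) (hle t e y ht hy)
      (h' t e x y ht hx hy hxy)).trans ?_
    gcongr
    exact le_iSup (fun e => DTSystem.worstValue F Z k (t + 1) (F t e y)) e

/-- On a bounded set only finitely many steps contribute to an excess, so that it inherits the
uniform continuity of the worst values. -/
theorem WorstValueDecays.uniformOnBounded_excess (h : WorstValueDecays F Z)
    (hW : ∀ k, UniformOnBounded (worstValue F Z k)) (m : ℕ) :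
    UniformOnBounded (excess F Z m) := by
  intro N ε hε
  obtain ⟨K, hK⟩ := h.vanishing N (threshold m) (threshold_pos m)
  choose δ hδ hle using fun k => hW k N (ε / 2 ^ K) (by positivity)
  obtain ⟨η, hη, -, hηδ⟩ := exists_pos_le_of_lt one_pos δ hδ K
  refine ⟨η, hη, fun t x y ht hx hy hxy => iSup_le fun k => ?_⟩
  rcases le_or_gt K k with hk | hk
  · rw [tsub_eq_zero_of_le (hK k t x hk ht hx), mul_zero]
    exact zero_le
  · have h1 := hle k t x y ht hx hy (hxy.trans_le (hηδ k hk))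
    calc 2 ^ k * (worstValue F Z k t x - threshold m)
        ≤ 2 ^ k * ((worstValue F Z k t y - threshold m) + ((ε / 2 ^ K : ℝ≥0) : ℝ≥0∞)) := by
          gcongr
          refine (tsub_le_tsub_right h1 _).trans ?_
          exact add_tsub_le_tsub_add
      _ ≤ 2 ^ k * (worstValue F Z k t y - threshold m)
            + ((2 ^ K : ℝ≥0) : ℝ≥0∞) * ((ε / 2 ^ K : ℝ≥0) : ℝ≥0∞) := by
          rw [mul_add]
          push_cast
          gcongr
          exact one_le_two
      _ ≤ excess F Z m t y + ε := by
          rw [← ENNReal.coe_mul, mul_div_cancel₀ _ (by positivity)]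
          gcongr
          exact le_iSup (fun k : ℕ => 2 ^ k * (worstValue F Z k t y - threshold m)) k

theorem WorstValueDecays.uniformOnBounded_valueSup (h : WorstValueDecays F Z)
    (hW : ∀ k, UniformOnBounded (worstValue F Z k)) {c : ℕ → ℝ≥0}
    (hc : IsExcessWeight F Z c) :
    UniformOnBounded (valueSup F Z c) := by
  intro N ε hε
  obtain ⟨M, hNM, hM⟩ := exists_half_pow_le hε N
  choose δ hδ hle using fun m => h.uniformOnBounded_excess hW m N ε hε
  obtain ⟨η, hη, -, hηδ⟩ := exists_pos_le_of_lt one_pos δ hδ M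
  refine ⟨η, hη, fun t x y ht hx hy hxy => iSup_le fun m => ?_⟩
  rcases le_or_gt M m with hm | hm
  · refine (hc.mul_excess_le m t x (by omega) (hx.trans ?_)).trans
      ((ENNReal.coe_le_coe.2 (hM m hm)).trans le_add_self)
    exact_mod_cast hNM.trans hm
  · calc c m * excess F Z m t x ≤ c m * (excess F Z m t y + ε) := by
          gcongr
          exact hle m t x y ht hx hy (hxy.trans_le (hηδ m hm))
      _ ≤ valueSup F Z c t y + ε := by
          rw [mul_add]
          gcongr
          · exact le_iSup (fun m : ℕ => c m * excess F Z m t y) m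
          · exact mul_le_of_le_one_left zero_le (by exact_mod_cast hc.le_one m)

/-- The function `z ↦ z / (1 + z) * ⨆ m, c m * (z - 1 / (m + 1))` is of class `K∞`; the supremum is
positive for `z > 0` and `1`-Lipschitz, and the first factor makes the product strictly monotone. -/
theorem exists_isKInf_le_of_threshold {c : ℕ → ℝ≥0} (hc : ∀ m, 0 < c m)
    (hc1 : ∀ m, c m ≤ 1) :
    ∃ a, IsKInf a ∧ ∀ z B : ℝ≥0, (∀ m, c m * (z - threshold m) ≤ B) → a z ≤ B := by
  set g : ℝ≥0 → ℝ≥0 := fun z => ⨆ m, c m * (z - threshold m) with hg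
  have hbdd : ∀ z, BddAbove (Set.range fun m => c m * (z - threshold m)) := fun z =>
    ⟨z, by
      rintro _ ⟨m, rfl⟩
      exact (mul_le_of_le_one_left zero_le (hc1 m)).trans tsub_le_self⟩
  have hle : ∀ z m, c m * (z - threshold m) ≤ g z := fun z m => le_ciSup (hbdd z) m
  have hmono : Monotone g := fun z w hzw => ciSup_mono (hbdd w) fun m => by gcongr
  have hpos : ∀ z, 0 < z → 0 < g z := by
    intro z hz
    obtain ⟨m, hm⟩ := exists_nat_one_div_lt (NNReal.coe_pos.2 hz)
    have hm' : threshold m < z := by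
      rw [← NNReal.coe_lt_coe]
      simpa [threshold] using hm
    exact (mul_pos (hc m) (tsub_pos_of_lt hm')).trans_le (hle z m)
  have hlip : ∀ z w : ℝ≥0, (g z : ℝ) ≤ g w + dist z w := by
    intro z w
    have h1 : g z ≤ g w + nndist z w := by
      refine ciSup_le' fun m => ?_
      have h2 : z ≤ w + nndist z w := by
        rw [← NNReal.coe_le_coe, NNReal.coe_add, coe_nndist, NNReal.dist_eq]
        linarith [le_abs_self ((z : ℝ) - w)]
      calc c m * (z - threshold m) ≤ c m * ((w - threshold m) + nndist z w) := by
            gcongr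
            exact (tsub_le_tsub_right h2 _).trans add_tsub_le_tsub_add
        _ ≤ g w + nndist z w := by
            rw [mul_add]
            exact add_le_add (hle w m) (mul_le_of_le_one_left zero_le (hc1 m))
    exact_mod_cast h1
  have hgc : Continuous g := by
    have := (LipschitzWith.of_le_add hlip).continuous
    exact NNReal.isEmbedding_coe.continuous_iff.2 this
  have hfrac : StrictMono fun z : ℝ≥0 => z / (1 + z) := by
    intro z w hzw
    show z / (1 + z) < w / (1 + w)
    rw [div_lt_div_iff₀ (by positivity) (by positivity), mul_add, mul_add, mul_one, mul_one,
      mul_comm w z]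
    exact add_lt_add_left hzw _
  refine ⟨fun z => z / (1 + z) * g z, ⟨?_, ?_, by simp, ?_⟩, fun z B hB => ?_⟩
  · refine Continuous.mul ?_ hgc
    exact continuous_id.div (by fun_prop) fun z => by positivity
  · intro z w hzw
    calc z / (1 + z) * g z ≤ z / (1 + z) * g w := by gcongr; exact hmono hzw.le
      _ < w / (1 + w) * g w := mul_lt_mul_of_pos_right (hfrac hzw) (hpos w (zero_le.trans_lt hzw))
  · -- For `z ≥ 1` the product is at least `(z - 1) c₀ / 2`.
    have hsub : Tendsto (fun z : ℝ≥0 => z - threshold 0) atTop atTop :=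
      tendsto_atTop_atTop.2 fun b => ⟨b + threshold 0, fun z hz => le_tsub_of_add_le_right hz⟩
    have hlim : Tendsto (fun z : ℝ≥0 => (1 / 2 * c 0) * (z - threshold 0)) atTop atTop :=
      hsub.const_mul_atTop (mul_pos (half_pos one_pos) (hc 0))
    refine tendsto_atTop_mono' _ ?_ hlim
    filter_upwards [eventually_ge_atTop 1] with z hz
    rw [mul_assoc]
    refine mul_le_mul ?_ (hle z 0) zero_le zero_le
    rw [div_le_div_iff₀ (by positivity) (by positivity), one_mul, mul_two]
    exact add_le_add_left hz z
  · refine (mul_le_of_le_one_left zero_le ?_).trans (ciSup_le' hB)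
    exact div_le_one_of_le₀ le_add_self zero_le

/-- Converse Lyapunov theorem: a quantity `Z` whose worst values decay is dominated by a function
that is halved at every step. -/
theorem WorstValueDecays.exists_lyapunov (h : WorstValueDecays F Z) :
    ∃ (V : ℕ → X → ℝ≥0) (a₁ a₂ β : ℝ≥0 → ℝ≥0), IsKInf a₁ ∧ IsKInf a₂ ∧ IsKPlus β ∧
      (∀ (t : ℕ) x, a₁ (Z t x) ≤ V t x ∧ V t x ≤ a₂ (β t * ‖x‖₊)) ∧
      (∀ t e x, V (t + 1) (F t e x) ≤ 1 / 2 * V t x) ∧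
      (RobustlyUniformOnBounded F → UniformOnBounded (fun t x => (Z t x : ℝ≥0∞)) →
        UniformOnBounded fun t x => (V t x : ℝ≥0∞)) := by
  obtain ⟨c, hc⟩ := h.exists_isExcessWeight
  obtain ⟨a₁, ha₁, hle₁⟩ := exists_isKInf_le_of_threshold hc.pos hc.le_one
  have hfin : ∀ t x, ((valueSup F Z c t x).toNNReal : ℝ≥0∞) = valueSup F Z c t x := by
    intro t x
    obtain ⟨B, hB⟩ := h.exists_valueSup_le hc (max t ⌈‖x‖₊⌉₊)
    refine ENNReal.coe_toNNReal (ne_top_of_le_ne_top ENNReal.coe_ne_top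
      (hB t x (le_max_left _ _) ((Nat.le_ceil _).trans ?_)))
    exact_mod_cast le_max_right _ _
  obtain ⟨a₂, β, ha₂, hβ, hle₂⟩ := exists_isKInf_isKPlus_bound
    (fun t x => (valueSup F Z c t x).toNNReal) (fun x : X => ‖x‖₊)
    (by
      intro n R
      obtain ⟨B, hB⟩ := h.exists_valueSup_le hc (max n ⌈R⌉₊)
      refine ⟨B, fun x hx => ?_⟩
      rw [← ENNReal.coe_le_coe, hfin]
      refine hB n x (le_max_left _ _) (hx.trans ((Nat.le_ceil R).trans ?_))
      exact_mod_cast le_max_right _ _)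
    (by
      intro n ε hε
      obtain ⟨δ, hδ, hle⟩ := h.valueSup_small hc n hε
      refine ⟨δ, hδ, fun x hx => ?_⟩
      rw [← ENNReal.coe_le_coe, hfin]
      exact hle n x le_rfl hx)
  refine ⟨fun t x => (valueSup F Z c t x).toNNReal, a₁, a₂, β, ha₁, ha₂, hβ,
    fun t x => ⟨hle₁ _ _ fun m => ?_, hle₂ t x⟩, fun t e x => ?_, fun hF hZ => ?_⟩
  · rw [← ENNReal.coe_le_coe, hfin]
    exact le_valueSup F Z c t m x
  · have h2 := two_mul_valueSup_le F Z c t e x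
    rw [← hfin t x, ← hfin (t + 1)] at h2
    have h3 : 2 * (valueSup F Z c (t + 1) (F t e x)).toNNReal ≤ (valueSup F Z c t x).toNNReal := by
      exact_mod_cast h2
    rw [one_div, inv_mul_eq_div, le_div_iff₀ two_pos, mul_comm]
    exact h3
  · simp only [hfin]
    exact h.uniformOnBounded_valueSup (hF.worstValue hZ) hc

end

/-! ### From the stability margin to a Lyapunov function -/

theorem exists_isSolution {X : Type*} (g : ℕ → X → X) (t₀ : ℕ) (x₀ : X) :
    ∃ x, IsSolution g t₀ x₀ x := by
  refine ⟨fun s => Nat.rec x₀ (fun k y => g (t₀ + k) y) (s - t₀), by simp, fun t ht => ?_⟩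
  obtain ⟨k, rfl⟩ := Nat.exists_eq_add_of_le ht
  simp [Nat.add_assoc]

/-- A bound along all trajectories bounds the worst value. At least one step is needed: over an empty
set of disturbances there are no trajectories, while `worstValue F Z 0 t x₀` is `Z t x₀`. -/
theorem worstValue_succ_le {E X : Type*} {F : ℕ → E → X → X} {Z : ℕ → X → ℝ≥0} {B : ℝ≥0∞} (k : ℕ)
    {t : ℕ} {x₀ : X} (h : ∀ (e : ℕ → E) (x : ℕ → X), IsSolution (fun s => F s (e s)) t x₀ x →
      (Z (t + (k + 1)) (x (t + (k + 1))) : ℝ≥0∞) ≤ B) : worstValue F Z (k + 1) t x₀ ≤ B := by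
  induction k generalizing t x₀ with
  | zero =>
    refine iSup_le fun e => ?_
    obtain ⟨x, hx⟩ := exists_isSolution (fun s => F s e) t x₀
    have := h (fun _ => e) x hx
    rwa [zero_add, hx.2 t le_rfl, hx.1] at this
  | succ k ih =>
    refine iSup_le fun e₀ => ih fun e x hx => ?_
    have := h (Function.update e t e₀) (Function.update x t x₀) ⟨by simp, fun s hs => ?_⟩
    · rw [Function.update_of_ne (by omega)] at this
      rwa [show t + 1 + (k + 1) = t + (k + 1 + 1) by omega]
    · rw [Function.update_of_ne (by omega)]
      rcases hs.eq_or_lt with rfl | hs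
      · simpa using hx.1
      · simpa [Function.update_of_ne hs.ne'] using hx.2 s hs

section

variable {D E X U Y : Type*}
  [NormedAddCommGroup X] [NormedAddCommGroup U] [NormedAddCommGroup Y]

theorem BoundedUniformOnBounded.exists_nnnorm_le {H : ℕ → X → Y} (h : BoundedUniformOnBounded H)
    (N : ℕ) : ∃ B : ℝ≥0, ∀ t x, t ≤ N → ‖x‖₊ ≤ N → ‖H t x‖₊ ≤ B := by
  obtain ⟨B, hB⟩ := isBounded_iff_forall_norm_le.1 (h (Set.Iic N) (Metric.closedBall 0 N)
    (Set.finite_Iic N).isBounded Metric.isBounded_closedBall 1 one_pos).1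
  refine ⟨B.toNNReal, fun t x ht hx => NNReal.le_toNNReal_of_coe_le (hB _ ⟨(t, x), ⟨ht, ?_⟩, rfl⟩)⟩
  exact mem_closedBall_zero_iff.2 hx

theorem BoundedUniformOnBounded.exists_nnnorm_sub_lt {H : ℕ → X → Y}
    (h : BoundedUniformOnBounded H) (N : ℕ) {ε : ℝ≥0} (hε : 0 < ε) :
    ∃ δ : ℝ≥0, 0 < δ ∧ ∀ t x y, t ≤ N → ‖x‖₊ ≤ N → ‖y‖₊ ≤ N → ‖x - y‖₊ < δ →
      ‖H t x - H t y‖₊ < ε := by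
  obtain ⟨δ, hδ, hle⟩ := (h (Set.Iic N) (Metric.closedBall 0 N)
    (Set.finite_Iic N).isBounded Metric.isBounded_closedBall ε hε).2
  lift δ to ℝ≥0 using hδ.le
  exact ⟨δ, hδ, fun t x y ht hx hy hxy => hle t ht x (mem_closedBall_zero_iff.2 hx) y
    (mem_closedBall_zero_iff.2 hy) hxy⟩

/-- An output-stable system stays stable when the output is augmented by a rapidly decreasing
multiple `μ t * ‖x‖` of the state, since the state has an a priori growth bound. -/
theorem IsRGAOS.exists_worstValueDecays {F : ℕ → E → X → X} {H : ℕ → X → Y} (h : IsRGAOS F H)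
    (hH : HypH2 H) {ω : ℕ → ℝ≥0 → ℝ≥0} (hω : ∀ t, IsGain (ω t))
    (hF : ∀ t e x, ‖F t e x‖₊ ≤ ω t ‖x‖₊) :
    ∃ μ, IsKPlus μ ∧ (∀ t : ℕ, μ t ≤ 1) ∧
      WorstValueDecays F fun t x => ‖H t x‖₊ + μ t * ‖x‖₊ := by
  obtain ⟨h₁, h₂, h₃⟩ := h
  obtain ⟨μ, hμ, hμ1, hfade⟩ := exists_weight_isFading _ (isGain_growthGain hω) fun _ => 1
  simp only [one_mul] at hfade
  have hsol : ∀ {t₀ x₀} {e : ℕ → E} {x : ℕ → X}, IsSolution (fun s => F s (e s)) t₀ x₀ x →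
      ∀ t, t₀ ≤ t → μ t * ‖x t‖₊ ≤ μ t * growthGain ω t ‖x₀‖₊ := fun hx t ht =>
    mul_le_mul_right (hx.nnnorm_le_growthGain hω (fun s => hF s _) ht) _
  refine ⟨μ, hμ, hμ1, fun N => ?_, fun N ε hε => ?_, fun N ε hε => ?_⟩
  · obtain ⟨A, hA⟩ := h₁ (N + 1) (by positivity) N
    obtain ⟨B, hB⟩ := hfade.bounded N
    obtain ⟨C, hC⟩ := hH.1.exists_nnnorm_le N
    refine ⟨(C + N) + (A.toNNReal + B), fun k t x₀ ht hx₀ => ?_⟩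
    rcases k with - | k
    · refine ENNReal.coe_le_coe.2 (le_add_right (add_le_add (hC t x₀ ht hx₀) ?_))
      exact (mul_le_of_le_one_left zero_le (hμ1 t)).trans hx₀
    · refine worstValue_succ_le k fun e x hx => ENNReal.coe_le_coe.2 (le_add_left (add_le_add ?_ ?_))
      · refine NNReal.le_toNNReal_of_coe_le (hA ⟨t, x₀, e, x, _, ht, ?_, hx, by omega, rfl⟩)
        have : (‖x₀‖₊ : ℝ) ≤ N := by exact_mod_cast hx₀
        rw [coe_nnnorm] at this
        linarith
      · exact (hsol hx _ (by omega)).trans ((hfade.monotone _ hx₀).trans (hB _))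
  · have hε2 : 0 < ε / 2 := half_pos hε
    obtain ⟨δ₁, hδ₁, hle₁⟩ := h₂ (ε / 2 : ℝ≥0) hε2 N
    lift δ₁ to ℝ≥0 using hδ₁.le
    obtain ⟨δ₂, hδ₂, hle₂⟩ := hfade.small (ε / 2) hε2
    obtain ⟨δ₃, hδ₃, hle₃⟩ := hH.1.exists_nnnorm_sub_lt (N + 1) hε2
    have hδ₃' : 0 < min 1 (min (ε / 2) (δ₃ / 2)) :=
      lt_min one_pos (lt_min hε2 (half_pos hδ₃))
    refine ⟨min (min δ₁ δ₂) (min 1 (min (ε / 2) (δ₃ / 2))), lt_min (lt_min hδ₁ hδ₂) hδ₃',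
      fun k t x₀ ht hx₀ => ?_⟩
    simp only [le_min_iff] at hx₀
    obtain ⟨⟨hx₁, hx₂⟩, hx₃, hx₄, hx₅⟩ := hx₀
    rw [← add_halves ε]
    rcases k with - | k
    · refine ENNReal.coe_le_coe.2 (add_le_add ?_ ?_)
      · have := hle₃ t x₀ 0 (by omega) (hx₃.trans (by simp)) (by simp)
          (by simpa using hx₅.trans_lt (NNReal.half_lt_self hδ₃.ne'))
        simpa [hH.2] using this.le
      · exact (mul_le_of_le_one_left zero_le (hμ1 t)).trans hx₄
    · refine worstValue_succ_le k fun e x hx => ENNReal.coe_le_coe.2 (add_le_add ?_ ?_)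
      · exact hle₁ t x₀ hx₁ ht e x hx _ (by omega)
      · exact (hsol hx _ (by omega)).trans ((hfade.monotone _ hx₂).trans (hle₂ _))
  · have hε2 : 0 < ε / 2 := half_pos hε
    obtain ⟨τ, hτ⟩ := h₃ (ε / 2 : ℝ≥0) hε2 N N (by positivity)
    obtain ⟨K, hK⟩ := hfade.vanishing (ε / 2) hε2 N
    refine ⟨τ + K + 1, fun k t x₀ hk ht hx₀ => ?_⟩
    obtain ⟨k, rfl⟩ := Nat.exists_eq_succ_of_ne_zero (by omega : k ≠ 0)
    rw [← add_halves ε]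
    refine worstValue_succ_le k fun e x hx => ENNReal.coe_le_coe.2 (add_le_add ?_ ?_)
    · exact hτ t x₀ (by exact_mod_cast hx₀) ht e x hx _ (by omega)
    · exact (hsol hx _ (by omega)).trans ((hfade.monotone _ hx₀).trans (hK _ (by omega)))

/-- Off the region `‖u‖ ≤ p t * θ ‖x‖` the state is controlled by the input, hence so is the value
of the Lyapunov function at the next step. -/
theorem exists_input_gain {f : ℕ → D → X → U → X} (hA : HypA1 f) {V : ℕ → X → ℝ≥0}
    {a₂ β θ p : ℝ≥0 → ℝ≥0} (ha₂ : IsKInf a₂) (hV : ∀ (t : ℕ) x, V t x ≤ a₂ (β t * ‖x‖₊))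
    (hθ : IsKInf θ) (hp : IsKPlus p) :
    ∃ a₃ φ, IsKInf a₃ ∧ IsKPlus φ ∧ ∀ (t : ℕ) x d u, p t * θ ‖x‖₊ < ‖u‖₊ →
      V (t + 1) (f t d x u) ≤ a₃ (φ t * ‖u‖₊) := by
  obtain ⟨a, b, ha, hb, hf⟩ := hA
  set w : ℕ → ℝ≥0 → ℝ≥0 := fun t s => a₂ (β (t + 1 : ℕ) * (a (b t * s) + a (b t * s))) with hw
  have hgain : ∀ t, IsGain (w t) := fun t =>
    ha₂.isGain.comp ((isGain_const_mul _).comp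
      ((ha.isGain.comp (isGain_const_mul _)).add (ha.isGain.comp (isGain_const_mul _))))
  have hle : ∀ t d x u s, ‖x‖₊ ≤ s → ‖u‖₊ ≤ s → V (t + 1) (f t d x u) ≤ w t s := by
    intro t d x u s hx hu
    refine (hV _ _).trans (ha₂.strictMono.monotone (mul_le_mul_right ((hf t x d u).trans ?_) _))
    exact add_le_add (ha.strictMono.monotone (mul_le_mul_right hx _))
      (ha.strictMono.monotone (mul_le_mul_right hu _))
  classical
  obtain ⟨a₃, φ, ha₃, hφ, h⟩ := exists_isKInf_isKPlus_bound
    (fun (t : ℕ) (q : D × X × U) =>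
      if p t * θ ‖q.2.1‖₊ < ‖q.2.2‖₊ then V (t + 1) (f t q.1 q.2.1 q.2.2) else 0)
    (fun q => ‖q.2.2‖₊)
    (by
      intro t R
      obtain ⟨S, hS⟩ := hθ.exists_le (R / p t)
      refine ⟨w t (max S R), fun q hq => ?_⟩
      split_ifs with hlt
      · refine hle t _ _ _ _ (le_max_of_le_left ?_) (le_max_of_le_right hq)
        refine (hθ.strictMono.lt_iff_lt.1 (lt_of_lt_of_le ?_ hS)).le
        rw [lt_div_iff₀' (hp.pos t)]
        exact hlt.trans_le hq
      · exact zero_le)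
    (by
      intro t ε hε
      obtain ⟨η, hη, hwη⟩ := (hgain t).exists_pos hε
      have hθη : 0 < θ η := hθ.map_zero ▸ hθ.strictMono hη
      refine ⟨min η (p t * θ η), lt_min hη (mul_pos (hp.pos t) hθη), fun q hq => ?_⟩
      split_ifs with hlt
      · refine (hle t _ _ _ η ?_ (hq.trans (min_le_left _ _))).trans (hwη η le_rfl)
        refine (hθ.strictMono.lt_iff_lt.1 ?_).le
        exact lt_of_mul_lt_mul_left (hlt.trans_le (hq.trans (min_le_right _ _))) zero_le
      · exact zero_le)
  refine ⟨a₃, φ, ha₃, hφ, fun t x d u hlt => ?_⟩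
  simpa only [if_pos hlt] using h t (d, x, u)

theorem HypA2.exists_nnnorm_le {f : ℕ → D → X → U → X} (h : HypA2 f) (N : ℕ) (R : ℝ≥0) :
    ∃ B : ℝ≥0, ∀ t d x u, t ≤ N → ‖x‖₊ ≤ R → ‖u‖₊ ≤ R → ‖f t d x u‖₊ ≤ B := by
  obtain ⟨B, hB⟩ := isBounded_iff_forall_norm_le.1 (h.1
    (Metric.closedBall 0 R ×ˢ Metric.closedBall 0 R) (Set.Iic N)
    (Metric.isBounded_closedBall.prod Metric.isBounded_closedBall)
    (Set.finite_Iic N).isBounded 1 one_pos).1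
  exact ⟨B.toNNReal, fun t d x u ht hx hu => NNReal.le_toNNReal_of_coe_le
    (hB _ ⟨t, ht, d, (x, u), ⟨mem_closedBall_zero_iff.2 hx, mem_closedBall_zero_iff.2 hu⟩, rfl⟩)⟩

theorem HypA2.exists_nnnorm_sub_lt {f : ℕ → D → X → U → X} (h : HypA2 f) (N : ℕ) (R : ℝ≥0)
    {ε : ℝ≥0} (hε : 0 < ε) :
    ∃ δ : ℝ≥0, 0 < δ ∧ ∀ t d x u y v, t ≤ N → ‖x‖₊ ≤ R → ‖u‖₊ ≤ R → ‖y‖₊ ≤ R → ‖v‖₊ ≤ R →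
      ‖x - y‖₊ + ‖u - v‖₊ < δ → ‖f t d x u - f t d y v‖₊ < ε := by
  obtain ⟨δ, hδ, hle⟩ := (h.1
    (Metric.closedBall 0 R ×ˢ Metric.closedBall 0 R) (Set.Iic N)
    (Metric.isBounded_closedBall.prod Metric.isBounded_closedBall)
    (Set.finite_Iic N).isBounded ε hε).2
  lift δ to ℝ≥0 using hδ.le
  refine ⟨δ, hδ, fun t d x u y v ht hx hu hy hv hlt => ?_⟩
  have hsup := hle t ht (x, u) ⟨mem_closedBall_zero_iff.2 hx, mem_closedBall_zero_iff.2 hu⟩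
    (y, v) ⟨mem_closedBall_zero_iff.2 hy, mem_closedBall_zero_iff.2 hv⟩
    (by exact_mod_cast hlt)
  rw [ENNReal.ofReal_coe_nnreal] at hsup
  exact ENNReal.coe_lt_coe.1
    ((le_iSup (fun d => ‖f t d x u - f t d y v‖ₑ) d).trans_lt hsup)

theorem HypA2.hypA1 {f : ℕ → D → X → U → X} (h : HypA2 f) : HypA1 f := by
  obtain ⟨a, β, ha, hβ, hle⟩ := exists_isKInf_isKPlus_bound
    (fun t (q : D × X × U) => ‖f t q.1 q.2.1 q.2.2‖₊) (fun q => max ‖q.2.1‖₊ ‖q.2.2‖₊)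
    (by
      intro t R
      obtain ⟨B, hB⟩ := h.exists_nnnorm_le t R
      exact ⟨B, fun q hq => hB t _ _ _ le_rfl ((le_max_left _ _).trans hq)
        ((le_max_right _ _).trans hq)⟩)
    (by
      intro t ε hε
      obtain ⟨δ, hδ, hlt⟩ := h.exists_nnnorm_sub_lt t 1 hε
      have hδ3 : 0 < δ / 3 := by positivity
      refine ⟨min 1 (δ / 3), lt_min one_pos hδ3, fun q hq => ?_⟩
      have hx := (le_max_left _ _).trans hq
      have hu := (le_max_right _ _).trans hq
      have := hlt t q.1 q.2.1 q.2.2 0 0 le_rfl (hx.trans (min_le_left _ _))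
        (hu.trans (min_le_left _ _)) (by simp) (by simp) ?_
      · simpa [h.2] using this.le
      · simp only [sub_zero]
        calc _ ≤ δ / 3 + δ / 3 :=
              add_le_add (hx.trans (min_le_right _ _)) (hu.trans (min_le_right _ _))
          _ < δ / 3 + δ / 3 + δ / 3 := lt_add_of_pos_right _ hδ3
          _ = δ := add_thirds δ)
  refine ⟨a, β, ha, hβ, fun t x d u => (hle t (d, x, u)).trans ?_⟩
  rw [mul_max, ha.strictMono.monotone.map_max]
  exact max_le le_self_add le_add_self

/-- For bounded, uniform dynamics the feedback perturbation keeps these properties, because `θ` is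
uniformly continuous on compact intervals. -/
theorem robustlyUniformOnBounded_feedbackDynamics [NormedSpace ℝ U] {f : ℕ → D → X → U → X}
    (hA : HypA2 f) {p θ : ℝ≥0 → ℝ≥0} (hθ : IsKInf θ) :
    RobustlyUniformOnBounded (feedbackDynamics f p θ) := by
  have hball : ∀ (e : Metric.closedBall (0 : U) 1) (c : ℝ), ‖c • (e : U)‖₊ ≤ ‖c‖₊ := by
    intro e c
    have he : ‖(e : U)‖₊ ≤ 1 := mem_closedBall_zero_iff.1 e.2
    rw [nnnorm_smul]
    exact mul_le_of_le_one_right zero_le he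
  set P : ℕ → ℝ≥0 := fun N => (Finset.range (N + 1)).sup fun t : ℕ => p t with hP
  have hpP : ∀ t N : ℕ, t ≤ N → p t ≤ P N := fun t N ht =>
    Finset.le_sup (f := fun t : ℕ => p t) (Finset.mem_range_succ_iff.2 ht)
  have hu : ∀ (t N : ℕ) (x : X) (e : Metric.closedBall (0 : U) 1), t ≤ N → ‖x‖₊ ≤ N →
      ‖((p t * θ ‖x‖₊ : ℝ≥0) : ℝ) • (e : U)‖₊ ≤ max (N : ℝ≥0) (P N * θ N) := by
    intro t N x e ht hx
    refine le_max_of_le_right ((hball _ _).trans ?_)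
    rw [NNReal.nnnorm_eq]
    exact mul_le_mul (hpP t N ht) (hθ.strictMono.monotone hx) zero_le zero_le
  refine ⟨fun N => ?_, fun N ε hε => ?_⟩
  · obtain ⟨B, hB⟩ := hA.exists_nnnorm_le N (max N (P N * θ N))
    exact ⟨⌈B⌉₊, fun t e x ht hx => (hB t e.1 x _ ht (le_max_of_le_left hx)
      (hu t N x e.2 ht hx)).trans (Nat.le_ceil B)⟩
  · obtain ⟨δ, hδ, hlt⟩ := hA.exists_nnnorm_sub_lt N (max N (P N * θ N)) hε
    have huc : UniformContinuousOn θ (Set.Icc 0 (N : ℝ≥0)) :=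
      isCompact_Icc.uniformContinuousOn_of_continuous hθ.continuous.continuousOn
    obtain ⟨η, hη, hθη⟩ := Metric.uniformContinuousOn_iff.1 huc (δ / 2 / (P N + 1) : ℝ≥0)
      (NNReal.coe_pos.2 (by positivity))
    lift η to ℝ≥0 using hη.le
    refine ⟨min η (δ / 2), lt_min hη (half_pos hδ), fun t e x y ht hx hy hxy => ?_⟩
    refine hlt t e.1 x _ y _ ht (le_max_of_le_left hx) (hu t N x e.2 ht hx)
      (le_max_of_le_left hy) (hu t N y e.2 ht hy) ?_
    have h1 : nndist (θ ‖x‖₊) (θ ‖y‖₊) < δ / 2 / (P N + 1) := by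
      refine hθη _ ⟨zero_le, hx⟩ _ ⟨zero_le, hy⟩ (lt_of_le_of_lt ?_ (hxy.trans_le (min_le_left _ _)))
      rw [NNReal.dist_eq]
      exact abs_norm_sub_norm_le x y
    have h2 : ‖((p t * θ ‖x‖₊ : ℝ≥0) : ℝ) • (e.2 : U) - ((p t * θ ‖y‖₊ : ℝ≥0) : ℝ) • (e.2 : U)‖₊
        ≤ δ / 2 := by
      rw [← sub_smul]
      refine (hball _ _).trans ?_
      calc ‖((p t * θ ‖x‖₊ : ℝ≥0) : ℝ) - ((p t * θ ‖y‖₊ : ℝ≥0) : ℝ)‖₊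
          = p t * nndist (θ ‖x‖₊) (θ ‖y‖₊) := by
            rw [NNReal.coe_mul, NNReal.coe_mul, ← mul_sub, nnnorm_mul, NNReal.nnnorm_eq]
            rfl
        _ ≤ (P N + 1) * (δ / 2 / (P N + 1)) :=
            mul_le_mul ((hpP t N ht).trans le_self_add) h1.le zero_le zero_le
        _ = δ / 2 := mul_div_cancel₀ _ (by positivity)
    calc _ < δ / 2 + δ / 2 := add_lt_add_of_lt_of_le (hxy.trans_le (min_le_right _ _)) h2
      _ = δ := add_halves δ

theorem HasStabilityMargin.exists_isLyapunov [NormedSpace ℝ U] {f : ℕ → D → X → U → X}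
    {H : ℕ → X → Y} (hH : HypH2 H) (hA : HypA1 f) (h : HasStabilityMargin f H) :
    ∃ V : ℕ → X → ℝ≥0, IsLyapunov f H V ∧
      (HypA2 f → UniformOnBounded fun t x => (V t x : ℝ≥0∞)) := by
  obtain ⟨θ, p, hθ, hp, hstab⟩ := h
  obtain ⟨a, b, ha, hb, hf⟩ := id hA
  obtain ⟨μ, hμ, hμ1, hdecay⟩ := hstab.exists_worstValueDecays hH
    (ω := fun t s => a (b t * s) + a (b t * (p t * θ s)))
    (fun t => (ha.isGain.comp (isGain_const_mul _)).add
      (ha.isGain.comp ((isGain_const_mul _).comp ((isGain_const_mul _).comp hθ.isGain))))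
    (by
      intro t e x
      refine (hf t x e.1 _).trans (add_le_add_right (ha.strictMono.monotone
        (mul_le_mul_right ?_ _)) _)
      have he : ‖(e.2 : U)‖₊ ≤ 1 := mem_closedBall_zero_iff.1 e.2.2
      rw [nnnorm_smul, NNReal.nnnorm_eq]
      exact mul_le_of_le_one_right zero_le he)
  obtain ⟨V, a₁, a₂, β, ha₁, ha₂, hβ, hV, hhalf, hunif⟩ := hdecay.exists_lyapunov
  obtain ⟨a₃, φ, ha₃, hφ, hin⟩ := exists_input_gain hA ha₂ (fun t x => (hV t x).2) hθ hp
  refine ⟨V, ⟨a₁, a₂, a₃, β, φ, μ, 1 / 2, ha₁, ha₂, ha₃, hβ, hφ, hμ, half_pos one_pos,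
    NNReal.half_lt_self one_ne_zero, hV, fun t x d u => ?_⟩, fun hA₂ =>
      hunif (robustlyUniformOnBounded_feedbackDynamics hA₂ hθ) ?_⟩
  · rcases lt_or_ge (p t * θ ‖x‖₊) ‖u‖₊ with hu | hu
    · exact (hin t x d u hu).trans le_add_self
    · -- Such an input is a feedback `p t * θ ‖x‖ • d'` with `d'` in the unit ball.
      obtain ⟨d', hd'⟩ : ∃ d' : Metric.closedBall (0 : U) 1,
          ((p t * θ ‖x‖₊ : ℝ≥0) : ℝ) • (d' : U) = u := by
        rcases eq_or_ne (p t * θ ‖x‖₊) 0 with h0 | h0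
        · refine ⟨⟨0, by simp⟩, ?_⟩
          rw [h0, nonpos_iff_eq_zero, nnnorm_eq_zero] at hu
          rw [hu, smul_zero]
        · refine ⟨⟨((p t * θ ‖x‖₊ : ℝ≥0) : ℝ)⁻¹ • u, ?_⟩, smul_inv_smul₀ (NNReal.coe_ne_zero.2 h0) u⟩
          rw [mem_closedBall_zero_iff, norm_smul, norm_inv, NNReal.norm_eq,
            inv_mul_le_iff₀ (NNReal.coe_pos.2 (pos_iff_ne_zero.2 h0)), mul_one]
          exact hu
      have := hhalf t (d, d') x
      simp only [feedbackDynamics, hd'] at this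
      exact this.trans le_self_add
  · intro N ε hε
    obtain ⟨δ, hδ, hle⟩ := hH.1.exists_nnnorm_sub_lt N (half_pos hε)
    refine ⟨min δ (ε / 2), lt_min hδ (half_pos hε), fun t x y ht hx hy hxy => ?_⟩
    rw [← ENNReal.coe_add, ENNReal.coe_le_coe]
    have h1 : ‖H t x‖₊ ≤ ‖H t y‖₊ + ε / 2 := by
      refine le_trans ?_ (add_le_add_right (hle t x y ht hx hy (hxy.trans_le (min_le_left _ _))).le _)
      simpa using nnnorm_add_le (H t y) (H t x - H t y)
    have h2 : μ t * ‖x‖₊ ≤ μ t * ‖y‖₊ + ε / 2 := by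
      have h3 : ‖x‖₊ ≤ ‖y‖₊ + ε / 2 := by
        refine le_trans ?_ (add_le_add_right (hxy.le.trans (min_le_right _ _)) _)
        simpa using nnnorm_add_le y (x - y)
      refine (mul_le_mul_right h3 _).trans ?_
      rw [mul_add]
      exact add_le_add_right (mul_le_of_le_one_left zero_le (hμ1 t)) _
    calc _ ≤ (‖H t y‖₊ + ε / 2) + (μ t * ‖y‖₊ + ε / 2) := add_le_add h1 h2
      _ = ‖H t y‖₊ + μ t * ‖y‖₊ + ε := by rw [add_add_add_comm, add_halves]

end

/-! ### Regularity of the Lyapunov function -/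

section

variable {D X U Y : Type*}
  [NormedAddCommGroup X] [NormedAddCommGroup U] [NormedAddCommGroup Y]

theorem UniformOnBounded.isCU {V : ℕ → X → ℝ≥0}
    (hV : UniformOnBounded fun t x => (V t x : ℝ≥0∞))
    (hb : ∀ N : ℕ, ∃ B : ℝ≥0, ∀ t x, t ≤ N → ‖x‖₊ ≤ N → V t x ≤ B) :
    IsCU fun t x => (V t x : ℝ) := by
  have hdist : ∀ (N : ℕ) (ε : ℝ), 0 < ε → ∃ δ : ℝ, 0 < δ ∧ ∀ t x y, t ≤ N → ‖x‖ ≤ N → ‖y‖ ≤ N →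
      ‖x - y‖ < δ → ‖(V t x : ℝ) - V t y‖ < ε := by
    intro N ε hε
    lift ε to ℝ≥0 using hε.le
    obtain ⟨δ, hδ, h⟩ := hV N (ε / 2) (half_pos hε)
    refine ⟨δ, hδ, fun t x y ht hx hy hxy => ?_⟩
    have h1 : V t x ≤ V t y + ε / 2 := by
      have := h t x y ht hx hy hxy
      dsimp only at this
      exact_mod_cast this
    have h2 : V t y ≤ V t x + ε / 2 := by
      rw [norm_sub_rev] at hxy
      have := h t y x ht hy hx hxy
      dsimp only at this
      exact_mod_cast this
    have h1' : (V t x : ℝ) ≤ V t y + ε / 2 := by exact_mod_cast h1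
    have h2' : (V t y : ℝ) ≤ V t x + ε / 2 := by exact_mod_cast h2
    have hε' : (0 : ℝ) < ε := hε
    rw [Real.norm_eq_abs, abs_lt]
    constructor <;> linarith
  refine ⟨continuous_prod_of_discrete_left.2 fun t => continuous_iff_continuousAt.2 fun x => ?_,
    fun I S hI hS ε hε => ?_⟩
  · refine Metric.continuousAt_iff.2 fun ε hε => ?_
    obtain ⟨N, hN⟩ := exists_nat_ge (max (t : ℝ) (‖x‖ + 1))
    obtain ⟨δ, hδ, h⟩ := hdist N ε hε
    refine ⟨min δ 1, lt_min hδ one_pos, fun {y} hy => ?_⟩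
    rw [dist_eq_norm] at hy ⊢
    refine h t y x (by exact_mod_cast (le_max_left _ _).trans hN) ?_ ?_ (hy.trans_le (min_le_left _ _))
    · have h1 := norm_le_norm_add_norm_sub' y x
      have h2 := (le_max_right _ _).trans hN
      have h3 := hy.trans_le (min_le_right _ _)
      linarith
    · linarith [(le_max_right _ _).trans hN]
  · obtain ⟨T, hT⟩ := hI.bddAbove
    obtain ⟨R, hR⟩ := isBounded_iff_forall_norm_le.1 hS
    obtain ⟨N, hN⟩ := exists_nat_ge (max (T : ℝ) R)
    have hIN : ∀ t ∈ I, t ≤ N := fun t ht =>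
      (hT ht).trans (by exact_mod_cast (le_max_left _ _).trans hN)
    have hSN : ∀ x ∈ S, ‖x‖ ≤ N := fun x hx => (hR x hx).trans ((le_max_right _ _).trans hN)
    obtain ⟨B, hB⟩ := hb N
    obtain ⟨δ, hδ, h⟩ := hdist N ε hε
    refine ⟨isBounded_iff_forall_norm_le.2 ⟨B, ?_⟩, δ, hδ, fun t ht x hx y hy hxy =>
      h t x y (hIN t ht) (hSN x hx) (hSN y hy) hxy⟩
    rintro _ ⟨⟨t, x⟩, ⟨ht, hx⟩, rfl⟩
    exact (NNReal.norm_eq _).trans_le (hB t x (hIN t ht) (hSN x hx))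

theorem IsLyapunov.exists_le {f : ℕ → D → X → U → X} {H : ℕ → X → Y} {V : ℕ → X → ℝ≥0}
    (h : IsLyapunov f H V) (N : ℕ) : ∃ B : ℝ≥0, ∀ t x, t ≤ N → ‖x‖₊ ≤ N → V t x ≤ B := by
  obtain ⟨a₁, a₂, a₃, β, φ, μ, lam, -, ha₂, -, -, -, -, -, -, hV, -⟩ := h
  refine ⟨(Finset.range (N + 1)).sup fun t => a₂ (β t * N), fun t x ht hx => ?_⟩
  refine ((hV t x).2.trans (ha₂.strictMono.monotone (mul_le_mul_right hx _))).trans ?_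
  exact Finset.le_sup (f := fun t : ℕ => a₂ (β t * N)) (Finset.mem_range_succ_iff.2 ht)

/-! ### From a Lyapunov function to input-to-output stability -/

/-- If `v` decreases at rate `l` up to inputs `w`, then at any slower rate `r` past inputs fade, at
the price of the factor `1 / (r - l)`. -/
theorem le_max_geometric_of_step {l r : ℝ≥0} (hlr : l < r) (hr : r < 1) {v w : ℕ → ℝ≥0} {t₀ : ℕ}
    (h : ∀ t, t₀ ≤ t → v (t + 1) ≤ l * v t + w t) {t : ℕ} (ht : t₀ ≤ t) :
    v t ≤ (r - l)⁻¹ * max (r ^ (t - t₀) * v t₀)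
      ((Finset.Icc t₀ t).sup fun τ => r ^ (t - τ) * w τ) := by
  have hrl : 0 < r - l := tsub_pos_of_lt hlr
  induction t, ht using Nat.le_induction with
  | base =>
    rw [inv_mul_eq_div, le_div_iff₀ hrl, Nat.sub_self, pow_zero, one_mul]
    exact (mul_le_of_le_one_right zero_le (tsub_le_self.trans hr.le)).trans (le_max_left _ _)
  | succ t ht ih =>
    set s := max (r ^ (t - t₀) * v t₀) ((Finset.Icc t₀ t).sup fun τ => r ^ (t - τ) * w τ) with hs
    set s' := max (r ^ (t + 1 - t₀) * v t₀)
      ((Finset.Icc t₀ (t + 1)).sup fun τ => r ^ (t + 1 - τ) * w τ) with hs'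
    have hss : r * s ≤ s' := by
      rw [hs, mul_max]
      refine max_le (le_max_of_le_left ?_) (le_max_of_le_right ?_)
      · rw [Nat.succ_sub ht, pow_succ', mul_assoc]
      · rw [NNReal.mul_finset_sup]
        refine Finset.sup_le fun τ hτ => ?_
        obtain ⟨h1, h2⟩ := Finset.mem_Icc.1 hτ
        have := Finset.le_sup (f := fun τ => r ^ (t + 1 - τ) * w τ)
          (Finset.mem_Icc.2 ⟨h1, h2.trans (Nat.le_succ t)⟩)
        refine le_trans (le_of_eq ?_) this
        rw [Nat.succ_sub h2, pow_succ', mul_assoc]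
    have hws : r * w t ≤ s' := by
      have := Finset.le_sup (f := fun τ => r ^ (t + 1 - τ) * w τ)
        (Finset.mem_Icc.2 ⟨ht, Nat.le_succ t⟩)
      refine le_max_of_le_right (le_trans (le_of_eq ?_) this)
      simp
    have hr0 : 0 < r := zero_le.trans_lt hlr
    refine (h t ht).trans (le_of_mul_le_mul_left ?_ hr0)
    calc r * (l * v t + w t) ≤ r * (l * ((r - l)⁻¹ * s) + w t) := by gcongr
      _ = l * (r - l)⁻¹ * (r * s) + r * w t := by ring
      _ ≤ l * (r - l)⁻¹ * s' + s' := by gcongr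
      _ = (l * (r - l)⁻¹ + (r - l) * (r - l)⁻¹) * s' := by
          rw [mul_inv_cancel₀ hrl.ne', add_mul, one_mul]
      _ = r * ((r - l)⁻¹ * s') := by
          rw [← add_mul, add_tsub_cancel_of_le hlr.le, mul_assoc]

theorem IsLyapunov.isIOS {f : ℕ → D → X → U → X} {H : ℕ → X → Y} {V : ℕ → X → ℝ≥0}
    (h : IsLyapunov f H V) : IsIOS f H := by
  obtain ⟨a₁, a₂, a₃, β, φ, μ, l, ha₁, ha₂, ha₃, hβ, hφ, hμ, hl, hl1, hV, hstep⟩ := h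
  obtain ⟨b, hb, hba⟩ := ha₁.exists_inverse
  -- A slower rate than `l` is the price for a supremum in place of a sum over past inputs.
  obtain ⟨r, hlr, hr⟩ := exists_between hl1
  have hr0 : 0 < r := hl.trans hlr
  have hM : 0 < (r - l)⁻¹ := inv_pos.2 (tsub_pos_of_lt hlr)
  -- One `KL` function has to serve initial states and inputs alike, hence the sum `a₂ + a₃`; the
  -- inputs enter through `max 1 β ≥ 1` times `φ t * ‖u‖`, so that `ρ` can be the identity.
  have ha := ha₂.add ha₃
  set σ : ℝ≥0 → ℝ≥0 → ℝ≥0 := fun s t => b ((r - l)⁻¹ * (r ^ (t : ℝ) * (a₂ s + a₃ s))) with hσdef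
  have hpow : ∀ t : ℝ≥0, 0 < r ^ (t : ℝ) := fun t => NNReal.rpow_pos hr0
  have hσ : IsKL σ := by
    refine ⟨?_, fun t s s' hs => ?_, fun t => ?_, fun s t t' ht => ?_, fun s => ?_⟩
    · have h1 : Continuous fun t : ℝ≥0 => r ^ (t : ℝ) :=
        NNReal.isEmbedding_coe.continuous_iff.2
        ((Real.continuous_const_rpow (NNReal.coe_ne_zero.2 hr0.ne')).comp NNReal.continuous_coe)
      exact hb.continuous.comp (continuous_const.mul ((h1.comp continuous_snd).mul
        (ha.continuous.comp continuous_fst)))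
    · exact hb.strictMono (mul_lt_mul_of_pos_left (mul_lt_mul_of_pos_left (ha.strictMono hs)
        (hpow t)) hM)
    · simp only [hσdef, ha₂.map_zero, ha₃.map_zero, add_zero, mul_zero, hb.map_zero]
    · refine hb.strictMono.monotone (mul_le_mul_right (mul_le_mul_left ?_ _) _)
      exact NNReal.rpow_le_rpow_of_exponent_ge hr0 hr.le (NNReal.coe_le_coe.2 ht)
    · have h1 : Tendsto (fun t : ℝ≥0 => r ^ (t : ℝ)) atTop (𝓝 0) :=
        NNReal.tendsto_coe.1 (by
          simpa [Function.comp_def] using (tendsto_rpow_atTop_of_base_lt_one (r : ℝ) (neg_one_lt_zero.trans_le r.2) hr).comp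
            (NNReal.tendsto_coe_atTop.2 tendsto_id))
      have h2 := (h1.mul_const (a₂ s + a₃ s)).const_mul (r - l)⁻¹
      rw [zero_mul, mul_zero] at h2
      exact (hb.continuous.tendsto' 0 0 hb.map_zero).comp h2
  refine ⟨σ, fun t => max 1 (β t), φ, fun s => s, hσ,
    ⟨continuous_const.max hβ.continuous, fun t => lt_max_of_lt_left one_pos⟩, hφ, IsKInf.id,
    fun u t₀ x₀ d x hx t ht => ?_⟩
  have hbound := le_max_geometric_of_step hlr hr (v := fun t => V t (x t))
    (w := fun t => a₃ (φ t * ‖u t‖₊)) (fun s hs => by rw [hx.2 s hs]; exact hstep s _ _ _) ht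
  have hHV : ‖H t (x t)‖₊ ≤ b (V t (x t)) := by
    rw [← hba ‖H t (x t)‖₊]
    exact hb.strictMono.monotone ((ha₁.strictMono.monotone le_self_add).trans (hV t _).1)
  have hmono : Monotone fun z => b ((r - l)⁻¹ * z) := fun z z' hz =>
    hb.strictMono.monotone (mul_le_mul_right hz _)
  refine (hHV.trans (hb.strictMono.monotone hbound)).trans ?_
  refine (hmono.map_max).le.trans (max_le_max (hmono ?_) ?_)
  · rw [NNReal.coe_natCast, NNReal.rpow_natCast]
    refine mul_le_mul_right (le_add_right ?_) _
    simp only [hx.1]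
    refine (hV t₀ x₀).2.trans (ha₂.strictMono.monotone (mul_le_mul_left (le_max_right _ _) _))
  · rw [Finset.apply_sup_eq_sup_comp_of_linearOrder _ hmono (by simp [hb.map_zero])]
    refine Finset.sup_mono_fun fun τ _ => hmono ?_
    rw [NNReal.coe_natCast, NNReal.rpow_natCast]
    refine mul_le_mul_right (le_add_left (ha₃.strictMono.monotone ?_)) _
    exact le_mul_of_one_le_left zero_le (le_max_left _ _)

end

end DTSystem

theorem proposition3p2 {D X U Y : Type*}
    [NormedAddCommGroup X] [NormedSpace ℝ X]
    [NormedAddCommGroup U] [NormedSpace ℝ U]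
    [NormedAddCommGroup Y] [NormedSpace ℝ Y]
    (f : ℕ → D → X → U → X) (H : ℕ → X → Y) (hH : DTSystem.HypH2 H) :
    (DTSystem.HypA1 f →
      List.TFAE [
        DTSystem.IsIOS f H,
        DTSystem.HasSupGainEstimate f H,
        DTSystem.HasStabilityMargin f H,
        ∃ V : ℕ → X → ℝ≥0, DTSystem.IsLyapunov f H V]) ∧
    (DTSystem.HypA2 f →
      List.TFAE [
        DTSystem.IsIOS f H,
        DTSystem.HasSupGainEstimate f H,
        DTSystem.HasStabilityMargin f H,
        ∃ V : ℕ → X → ℝ≥0, DTSystem.IsLyapunov f H V,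
        ∃ V : ℕ → X → ℝ≥0, DTSystem.IsLyapunov f H V ∧
          DTSystem.IsCU (fun t x => (V t x : ℝ))]) := by
  refine ⟨fun hA => ?_, fun hA => ?_⟩
  · tfae_have 1 → 2 := fun h => h.hasSupGainEstimate
    tfae_have 2 → 3 := fun h => h.hasStabilityMargin hA
    tfae_have 3 → 4 := fun h => (h.exists_isLyapunov hH hA).imp fun V hV => hV.1
    tfae_have 4 → 1 := fun ⟨V, hV⟩ => hV.isIOS
    tfae_finish
  · tfae_have 1 → 2 := fun h => h.hasSupGainEstimate
    tfae_have 2 → 3 := fun h => h.hasStabilityMargin hA.hypA1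
    tfae_have 3 → 5 := fun h => (h.exists_isLyapunov hH hA.hypA1).imp fun V hV =>
      ⟨hV.1, (hV.2 hA).isCU hV.1.exists_le⟩
    tfae_have 5 → 4 := fun ⟨V, hV⟩ => ⟨V, hV.1⟩
    tfae_have 4 → 1 := fun ⟨V, hV⟩ => hV.isIOS
    tfae_finish
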